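/- Let $F:\mathbb{R}^d\to\mathbb{R}$ be differentiable and bounded from below, $F^\star=\inf F$, with $L$-Lipschitz gradient, and let $f(x;\xi)$ be a loss, differentiable in $x$; a stochastic first-order oracle queried at $x$ returns $\nabla f(x;\xi)$ for a random sample $\xi$. Fix a reference point $y\in\mathbb{R}^d$ at which the exact gradient $\nabla F(y)$ is known. Given a deterministic $x^1$ and step sizes $\alpha_t=a/(t+1)^{\eta}$ with $a>0$, $\eta\in[1/2,1)$, the method N-SGE is, for $t=1,2,\dots$, $$x^{t+1}=x^t-\alpha_t\,\Psi\big(\nabla f(x^t;\xi_1^t)-\nabla f(y;\xi_2^t)+\nabla F(y)\big).$$ Noise. The vectors $z_1^t=\nabla f(x^t;\xi_1^t)-\nabla F(x^t)$ and $z_2^t=\nabla f(y;\xi_2^t)-\nabla F(y)$, $t\ge1$, are all independent and identically distributed with a probability density $P$ on $\mathbb{R}^d$ (no symmetry, no moments assumed) such that, for some $E_0>0$ and all $\|x\|\le E_0$, the set $S_x=\{u: P(u)>0,\ P(u-x)>0\}$ has positive Lebesgue measure. Nonlinearity. $\Psi:\mathbb{R}^d\to\mathbb{R}^d$ is of one of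 two forms. (a) Component-wise, $\Psi(x)=(\psi(x_1),\dots,\psi(x_d))$, where $\psi:\mathbb{R}\to\mathbb{R}$ is bounded, odd, non-decreasing, continuous except at finitely many points, piecewise differentiable with bounded derivative, and either discontinuous at $0$ or strictly increasing on some $(-c_2,c_2)$, $c_2>0$. (b) Joint, $\Psi(x)=x\,\varphi(\|x\|)$, where $\varphi:\mathbb{R}\to\mathbb{R}$ is continuous except at finitely many points, non-increasing and positive on $(0,\infty)$, $a\mapsto a\varphi(a)$ is non-decreasing on $(0,\infty)$, and $x\mapsto x\varphi(\|x\|)$ is bounded. Let $C>0$ satisfy $\|\Psi(x)\|\le C$ for all $x$. Let $\Phi(v)=\mathbb{E}[\Psi(v+z_1-z_2)]$, where $z_1,z_2$ are independent with density $P$. Then there are constants $\gamma_1,\gamma_2>0$, depending only on $P$ and $\Psi$, such that $$\langle\Phi(v),v\rangle\ \ge\ \min\{\gamma_1\|v\|,\ \gamma_2\|v\|^2\}\qquad\text{for all } v\in\mathbb{R}^d. \tag{$*$}$$ Moreover, for any $\gamma_1,\gamma_2>0$ satisfying $(*)$, with $\gamma=\min\{\gamma_1,\gamma_2\}$: if $$a\le\min\Big\{1,\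 \frac{\gamma_2}{8C^2},\ \frac{(1-\eta)\gamma_1}{8C^2\big(LC+(1-\eta)\|\nabla F(x^1)\|\big)}\Big\}$$ (the last bound being void if its denominator is $0$), then for every $t\ge1$ and every $\delta\in(0,1)$, with probability at least $1-\delta$, $$\frac1t\sum_{k=1}^t\min\{\|\nabla F(x^k)\|,\|\nabla F(x^k)\|^2\}\ \le\ \frac{4\big(\log(1/\delta)+F(x^1)-F^\star\big)}{a\gamma\,t^{1-\eta}}+\frac{2aLC^2}{\gamma\,t^{1-\eta}}\sum_{k=1}^t(k+1)^{-2\eta}.$$ In particular the left side is $O\big(t^{\eta-1}(\log(1/\delta)+\sum_{k=1}^t(k+1)^{-2\eta})\big)$, with a constant independent of $t$ and $\delta$. -/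

import Mathlib

open MeasureTheory ProbabilityTheory
open scoped NNReal ENNReal

/-- `ℝ^d` with the Euclidean norm and inner product. -/
abbrev Vec (d : ℕ) : Type := EuclideanSpace ℝ (Fin d)

/-- The population cost is differentiable, bounded from below, and its gradient is
`L`-Lipschitz. -/
structure IsSmoothCost {d : ℕ} (F : Vec d → ℝ) (L : ℝ≥0) : Prop where
  differentiable : Differentiable ℝ F
  bddBelow : BddBelow (Set.range F)
  lipschitz : LipschitzWith L (gradient F)

/-- `P` is a probability density function with respect to Lebesgue measure on `ℝ^d`. -/
structure IsPDF {d : ℕ} (P : Vec d → ℝ) : Prop where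
  measurable : Measurable P
  nonneg : ∀ z, 0 ≤ P z
  lintegral_eq_one : ∫⁻ z, ENNReal.ofReal (P z) = 1

/-- The probability measure on `ℝ^d` with density `P`. -/
noncomputable def noiseLaw {d : ℕ} (P : Vec d → ℝ) : Measure (Vec d) :=
  volume.withDensity fun z => ENNReal.ofReal (P z)

/-- For some `E₀ > 0` and all `‖x‖ ≤ E₀`, the set `S_x = {y : P y > 0 and P (y - x) > 0}` has
positive Lebesgue measure. -/
def HasPositiveOverlap {d : ℕ} (P : Vec d → ℝ) : Prop :=
  ∃ E₀ : ℝ, 0 < E₀ ∧ ∀ x : Vec d, ‖x‖ ≤ E₀ →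
    0 < volume {y : Vec d | 0 < P y ∧ 0 < P (y - x)}

/-- The random vectors `Z i` are independent and identically distributed with density `P`. -/
structure IsIIDWithPDF {d : ℕ} {Ω ι : Type*} [MeasurableSpace Ω] (μ : Measure Ω)
    (Z : ι → Ω → Vec d) (P : Vec d → ℝ) : Prop where
  measurable : ∀ i, Measurable (Z i)
  indep : iIndepFun Z μ
  law : ∀ i, μ.map (Z i) = noiseLaw P

/-- The conditions on the scalar map `ψ` of a component-wise nonlinearity. -/
structure IsComponentMap (ψ : ℝ → ℝ) : Prop where
  finite_discontinuities : {x | ¬ ContinuousAt ψ x}.Finite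
  piecewise_differentiable : ∃ c₁ : ℝ, 0 < c₁ ∧ ∃ s : Set ℝ, s.Finite ∧
    ∀ x, x ∉ s → DifferentiableAt ℝ ψ x ∧ |deriv ψ x| ≤ c₁
  monotone : Monotone ψ
  odd : ∀ x, ψ (-x) = -ψ x
  nondegenerate : ¬ ContinuousAt ψ 0 ∨
    ∃ c₂ : ℝ, 0 < c₂ ∧ StrictMonoOn ψ (Set.Ioo (-c₂) c₂)
  bounded : ∃ C₁ : ℝ, 0 < C₁ ∧ ∀ x, |ψ x| ≤ C₁

/-- The conditions on the radial factor `φ` of a joint nonlinearity `x ↦ φ(‖x‖) x` on `ℝ^d`. -/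
structure IsRadialFactor (d : ℕ) (φ : ℝ → ℝ) : Prop where
  finite_discontinuities : {x | ¬ ContinuousAt φ x}.Finite
  monotoneOn_mul : MonotoneOn (fun a => a * φ a) (Set.Ioi 0)
  antitoneOn : AntitoneOn φ (Set.Ioi 0)
  pos : ∀ a, 0 < a → 0 < φ a
  bounded : ∃ C₂ : ℝ, 0 < C₂ ∧ ∀ x : Vec d, ‖φ ‖x‖ • x‖ ≤ C₂

/-- The nonlinearity is either component-wise, `Ψ(x) = (ψ(x_1), …, ψ(x_d))`, or joint,
`Ψ(x) = x φ(‖x‖)`, with `ψ`, respectively `φ`, as above. -/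
def IsAdmissibleNonlinearity {d : ℕ} (Ψ : Vec d → Vec d) : Prop :=
  (∃ ψ : ℝ → ℝ, IsComponentMap ψ ∧ ∀ (x : Vec d) (i : Fin d), Ψ x i = ψ (x i)) ∨
  (∃ φ : ℝ → ℝ, IsRadialFactor d φ ∧ ∀ x : Vec d, Ψ x = φ ‖x‖ • x)

/-- The denoised nonlinearity `Φ(v) = E[Ψ(v + z₁ - z₂)]`, where `z₁` and `z₂` are independent
with density `P`. -/
noncomputable def denoised {d : ℕ} (P : Vec d → ℝ) (Ψ : Vec d → Vec d) (v : Vec d) : Vec d :=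
  ∫ z : Vec d × Vec d, Ψ (v + (z.1 - z.2)) ∂((noiseLaw P).prod (noiseLaw P))

/-- `γ₁, γ₂ > 0` satisfy `⟨Φ(v), v⟩ ≥ min {γ₁ ‖v‖, γ₂ ‖v‖²}` for every `v`, where `Φ` is the
denoised nonlinearity. They are tied only to the noise density and to the nonlinearity. -/
def AreDenoisingConstants {d : ℕ} (P : Vec d → ℝ) (Ψ : Vec d → Vec d) (γ₁ γ₂ : ℝ) : Prop :=
  0 < γ₁ ∧ 0 < γ₂ ∧
    ∀ v : Vec d, min (γ₁ * ‖v‖) (γ₂ * ‖v‖ ^ 2) ≤ inner ℝ (denoised P Ψ v) v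

/-- The answer `∇f(x; ξ)` of the stochastic first-order oracle to the query `x` with sample `ξ`;
the gradient is in `x`. -/
noncomputable def stochGrad {d : ℕ} {Ξ : Type*} (f : Vec d → Ξ → ℝ) (x : Vec d) (ξ : Ξ) : Vec d :=
  gradient (fun u => f u ξ) x

/-- The step-size schedule `α_t = a / (t + 1)^η`. -/
noncomputable def stepSize (a η : ℝ) (t : ℕ) : ℝ := a / ((t : ℝ) + 1) ^ η

/-- The process `x^1, x^2, …` is generated by the method with initial model `x₁`, reference
point `y`, samples `ξ₁^t`, `ξ₂^t`, and step sizes `α_t`, for `t = 1, 2, …`: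
`x^{t+1} = x^t - α_t Ψ(∇f(x^t; ξ₁^t) - ∇f(y; ξ₂^t) + ∇F(y))`. The values at time `0` are not
used. -/
structure IsNSGE {d : ℕ} {Ω Ξ : Type*} (F : Vec d → ℝ) (f : Vec d → Ξ → ℝ) (Ψ : Vec d → Vec d)
    (α : ℕ → ℝ) (x₁ y : Vec d) (ξ₁ ξ₂ : ℕ → Ω → Ξ) (x : ℕ → Ω → Vec d) : Prop where
  init : ∀ ω, x 1 ω = x₁
  step : ∀ t : ℕ, 1 ≤ t → ∀ ω, x (t + 1) ω =
    x t ω - α t • Ψ (stochGrad f (x t ω) (ξ₁ t ω) - stochGrad f y (ξ₂ t ω) + gradient F y)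

/-- All gradient noise vectors of the method, as one family indexed by two copies of
`{1, 2, …}`: `z₁^t = ∇f(x^t; ξ₁^t) - ∇F(x^t)` and `z₂^t = ∇f(y; ξ₂^t) - ∇F(y)`. -/
noncomputable def gradNoise {d : ℕ} {Ω Ξ : Type*} (F : Vec d → ℝ) (f : Vec d → Ξ → ℝ) (y : Vec d)
    (ξ₁ ξ₂ : ℕ → Ω → Ξ) (x : ℕ → Ω → Vec d) : ℕ+ ⊕ ℕ+ → Ω → Vec d
  | Sum.inl t => fun ω => stochGrad f (x t ω) (ξ₁ t ω) - gradient F (x t ω)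
  | Sum.inr t => fun ω => stochGrad f y (ξ₂ t ω) - gradient F y

/-! ### The law of the difference of two noise vectors. -/

section Noise

variable {d : ℕ} {P : Vec d → ℝ}

/-! Drift bound. The difference `z₁ - z₂` is symmetric whatever the density is, and near the origin
its law dominates a multiple of Lebesgue measure: a density exceeds some `ε` on a compact `K` of
positive volume, and `K` meets all its small translates in volume bounded below. Let `h` be the
component of `Ψ` along a unit vector `u`, where `u` is a coordinate vector in the component-wise
case and arbitrary in the joint case. It is odd, so its noise average vanishes, and it is
non-decreasing along `u`. Hence the average of `h (r • u + z)` is the average of the nonnegative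
increment `h (z + r • u) - h z`, and may be bounded below on a slab around the origin alone. There,
translation gains a layer where `h ≥ m` and loses one where `h ≤ 0`, which gives growth linear in
`r` (`IsPDF.exists_linear_growth`).

High probability. Write `g` for the gradient at the current iterate, `α` for the step size and `b`
for the lower bound on the drift `⟨Φ(g), g⟩`. The reference gradient cancels, so the update uses `Ψ
(g + z₁ - z₂)` with noise independent of the past. Hoeffding's lemma bounds the exponential moment
of the centred `-α⟨Ψ, g⟩` by `exp (α² C² ‖g‖² / 2)`. As `Ψ` is bounded, `‖g‖` grows at most like
`t^(1-η)`, which the decay `t^(-η)` of the steps compensates because `η ≥ 1/2`; the cap on `a` then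
yields `α C² ‖g‖² ≤ b` (`IsNSGE.stepSize_mul_sq_le`). Half of the drift thus pays for the
fluctuations: `exp (∑ (α b / 2 - α⟨Ψ, g⟩))` has mean at most one (`lintegral_exp_sum_le_one`).
Markov's inequality and the descent of `F` finish the proof. -/

theorem isProbabilityMeasure_noiseLaw (hP : IsPDF P) : IsProbabilityMeasure (noiseLaw P) :=
  ⟨by rw [noiseLaw, withDensity_apply _ MeasurableSet.univ, Measure.restrict_univ,
    hP.lintegral_eq_one]⟩

/-- The law of the difference of two independent noise vectors. -/
noncomputable def noiseDiffLaw {d : ℕ} (P : Vec d → ℝ) : Measure (Vec d) :=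
  ((noiseLaw P).prod (noiseLaw P)).map fun z => z.1 - z.2

theorem isProbabilityMeasure_noiseDiffLaw (hP : IsPDF P) :
    IsProbabilityMeasure (noiseDiffLaw P) := by
  have := isProbabilityMeasure_noiseLaw hP
  exact Measure.isProbabilityMeasure_map (by fun_prop)

/-- A density is bounded below by a positive constant on a compact set of positive volume. -/
theorem IsPDF.exists_smul_restrict_le (hP : IsPDF P) :
    ∃ K : Set (Vec d), IsCompact K ∧ 0 < volume K ∧
      ∃ ε : ℝ≥0∞, 0 < ε ∧ ε • volume.restrict K ≤ noiseLaw P := by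
  have hm : Measurable fun z => ENNReal.ofReal (P z) := hP.measurable.ennreal_ofReal
  -- If all these superlevel sets were null, the density would vanish almost everywhere.
  obtain ⟨n, hn⟩ : ∃ n : ℕ, 0 < volume {z | ((n : ℝ≥0∞) + 1)⁻¹ ≤ ENNReal.ofReal (P z)} := by
    by_contra! h
    have hU : volume (⋃ n : ℕ, {z | ((n : ℝ≥0∞) + 1)⁻¹ ≤ ENNReal.ofReal (P z)}) = 0 :=
      measure_iUnion_null fun n => le_antisymm (h n) bot_le
    have h0 : ∫⁻ z, ENNReal.ofReal (P z) = 0 := by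
      rw [lintegral_eq_zero_iff hm]
      refine measure_mono_null (fun z hz => ?_) hU
      have hz' : ENNReal.ofReal (P z) ≠ 0 := hz
      obtain ⟨n, hn⟩ := ENNReal.exists_inv_nat_lt hz'
      refine Set.mem_iUnion.2 ⟨n, le_trans ?_ hn.le⟩
      exact ENNReal.inv_le_inv.2 le_self_add
    rw [hP.lintegral_eq_one] at h0
    exact one_ne_zero h0
  obtain ⟨K, hKA, hK, hK0⟩ := MeasurableSet.exists_lt_isCompact
    (measurableSet_le measurable_const hm) hn
  refine ⟨K, hK, hK0, ((n : ℝ≥0∞) + 1)⁻¹, by simp, ?_⟩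
  have hKm := hK.measurableSet
  rw [noiseLaw, ← withDensity_const, ← withDensity_indicator hKm]
  refine withDensity_mono (Filter.Eventually.of_forall fun z => ?_)
  by_cases hz : z ∈ K
  · simpa [hz] using hKA hz
  · simp [hz]

/-- A compact set of positive volume overlaps uniformly with its small translates. -/
theorem IsCompact.exists_le_volume_inter_translate {K : Set (Vec d)} (hK : IsCompact K)
    (hK0 : 0 < volume K) :
    ∃ ρ : ℝ, 0 < ρ ∧ ∃ κ : ℝ≥0∞, 0 < κ ∧
      ∀ w ∈ Metric.ball (0 : Vec d) ρ, κ ≤ volume (K ∩ (fun z => w + z) ⁻¹' K) := by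
  have hfin := hK.measure_lt_top (μ := (volume : Measure (Vec d)))
  -- Since `U` contains `K` and its small translates, inclusion-exclusion leaves an overlap of at
  -- least `2 vol K - vol U > 0`.
  obtain ⟨U, hKU, hUo, hU⟩ := K.exists_isOpen_lt_of_lt (μ := volume) (2 * volume K) (by
    rw [two_mul]; exact ENNReal.lt_add_right hfin.ne hK0.ne')
  obtain ⟨ρ, hρ, hthick⟩ := hK.exists_thickening_subset_open hUo hKU
  refine ⟨ρ, hρ, 2 * volume K - volume U, tsub_pos_of_lt hU, fun w hw => ?_⟩
  rw [mem_ball_zero_iff] at hw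
  have hVm : MeasurableSet ((fun z => w + z) ⁻¹' K) := hK.measurableSet.preimage (by fun_prop)
  have hsub : K ∪ (fun z => w + z) ⁻¹' K ⊆ U := by
    refine Set.union_subset hKU fun z hz => hthick ?_
    rw [Metric.mem_thickening_iff]
    exact ⟨w + z, hz, by simpa [dist_eq_norm] using hw⟩
  have hV : volume ((fun z => w + z) ⁻¹' K) = volume K := measure_preimage_add volume w K
  rw [tsub_le_iff_right]
  calc 2 * volume K = volume (K ∩ (fun z => w + z) ⁻¹' K) + volume (K ∪ (fun z => w + z) ⁻¹' K) := by
        rw [add_comm, measure_union_add_inter _ hVm, hV, two_mul]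
    _ ≤ _ := by gcongr

/-- Near the origin, the difference of two independent noise vectors dominates a multiple of
Lebesgue measure. -/
theorem IsPDF.exists_smul_restrict_ball_le (hP : IsPDF P) :
    ∃ ρ : ℝ, 0 < ρ ∧ ∃ c : ℝ≥0∞, 0 < c ∧ c ≠ ∞ ∧
      c • volume.restrict (Metric.ball (0 : Vec d) ρ) ≤ noiseDiffLaw P := by
  have := isProbabilityMeasure_noiseLaw hP
  obtain ⟨K, hK, hK0, ε, hε, hle⟩ := hP.exists_smul_restrict_le
  obtain ⟨ρ, hρ, κ, hκ, hκle⟩ := hK.exists_le_volume_inter_translate hK0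
  have hKm := hK.measurableSet
  suffices h : ∃ c : ℝ≥0∞, 0 < c ∧
      c • volume.restrict (Metric.ball (0 : Vec d) ρ) ≤ noiseDiffLaw P by
    obtain ⟨c, hc, h⟩ := h
    -- Capping at `1` makes the constant finite, so that it can be used as a real number.
    refine ⟨ρ, hρ, min c 1, lt_min hc one_pos, (min_le_right _ _).trans_lt ENNReal.one_lt_top |>.ne,
      le_trans ?_ h⟩
    refine Measure.le_iff.2 fun s _ => ?_
    simp only [Measure.smul_apply, smul_eq_mul]
    gcongr
    exact min_le_left _ _
  -- One `ε` for each noise vector; `κ` bounds the overlap, over which the convolution integral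
  -- runs.
  refine ⟨ε * ε * κ, by simp [hε.ne', hκ.ne', pos_iff_ne_zero], Measure.le_iff.2 fun B hB => ?_⟩
  have hS : MeasurableSet {p : Vec d × Vec d | p.1 + p.2 ∈ K ∧ p.2 ∈ K ∧ p.1 ∈ B} := by
    exact (hKm.preimage (by fun_prop : Measurable fun p : Vec d × Vec d => p.1 + p.2)).inter
      ((hKm.preimage measurable_snd).inter (hB.preimage measurable_fst))
  have hT : MeasurableSet {p : Vec d × Vec d | p.1 ∈ K ∧ p.2 ∈ K ∧ p.1 - p.2 ∈ B} := by
    exact (hKm.preimage measurable_fst).inter ((hKm.preimage measurable_snd).inter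
      (hB.preimage (by fun_prop : Measurable fun p : Vec d × Vec d => p.1 - p.2)))
  -- The volume-preserving substitution `(z₁, z₂) ↦ (z₁ - z₂, z₂)`.
  have hshift : (volume.prod volume) {p : Vec d × Vec d | p.1 ∈ K ∧ p.2 ∈ K ∧ p.1 - p.2 ∈ B} =
      (volume.prod volume) {p : Vec d × Vec d | p.1 + p.2 ∈ K ∧ p.2 ∈ K ∧ p.1 ∈ B} := by
    rw [Measure.prod_apply_symm hT, Measure.prod_apply_symm hS]
    refine lintegral_congr fun z => ?_
    rw [← measure_preimage_add_right volume z]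
    congr 1
    ext w
    simp only [Set.mem_preimage, Set.mem_ofPred_eq, add_sub_cancel_right]
  have hlow : κ * volume (B ∩ Metric.ball (0 : Vec d) ρ) ≤
      (volume.prod volume) {p : Vec d × Vec d | p.1 + p.2 ∈ K ∧ p.2 ∈ K ∧ p.1 ∈ B} := by
    rw [Measure.prod_apply hS, ← setLIntegral_const,
      ← lintegral_indicator (hB.inter measurableSet_ball)]
    refine lintegral_mono fun w => ?_
    by_cases hw : w ∈ B ∩ Metric.ball (0 : Vec d) ρ
    · rw [Set.indicator_of_mem hw]
      refine (hκle w hw.2).trans (measure_mono fun z hz => ?_)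
      exact ⟨hz.2, hz.1, hw.1⟩
    · simp [Set.indicator_of_notMem hw]
  calc (ε * ε * κ) • volume.restrict (Metric.ball (0 : Vec d) ρ) B
      = ε * ε * (κ * volume (B ∩ Metric.ball (0 : Vec d) ρ)) := by
        rw [Measure.restrict_apply hB, smul_eq_mul, mul_assoc]
    _ ≤ ε * ε * (volume.prod volume) {p : Vec d × Vec d | p.1 ∈ K ∧ p.2 ∈ K ∧ p.1 - p.2 ∈ B} := by
        rw [hshift]; gcongr
    _ = ((ε • volume.restrict K).prod (ε • volume.restrict K)) {p | p.1 - p.2 ∈ B} := by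
        rw [Measure.prod_smul_left, Measure.prod_smul_right, Measure.prod_restrict]
        simp only [Measure.smul_apply, smul_eq_mul]
        rw [Measure.restrict_apply' (hKm.prod hKm), mul_assoc]
        congr 3
        ext p
        simp only [Set.mem_ofPred_eq, Set.mem_inter_iff, Set.mem_prod]
        tauto
    _ ≤ ((noiseLaw P).prod (noiseLaw P)) {p | p.1 - p.2 ∈ B} := Measure.prod_mono hle hle _
    _ = noiseDiffLaw P B := by
        rw [noiseDiffLaw, Measure.map_apply (by fun_prop) hB]; rfl

/-- Exchanging the two independent copies changes the sign of their difference, so no symmetry of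
the density is needed. -/
theorem integral_noiseDiffLaw_neg {E : Type*} [NormedAddCommGroup E] [NormedSpace ℝ E]
    (hP : IsPDF P) {g : Vec d → E} (hg : StronglyMeasurable g) :
    ∫ z, g (-z) ∂noiseDiffLaw P = ∫ z, g z ∂noiseDiffLaw P := by
  have := isProbabilityMeasure_noiseLaw hP
  have hgn : StronglyMeasurable fun z => g (-z) := hg.comp_measurable measurable_neg
  rw [noiseDiffLaw, integral_map (by fun_prop) hg.aestronglyMeasurable,
    integral_map (by fun_prop) hgn.aestronglyMeasurable,
    ← integral_prod_swap]
  simp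

theorem integral_noiseDiffLaw_of_odd (hP : IsPDF P) {g : Vec d → ℝ} (hg : Measurable g)
    (hodd : ∀ z, g (-z) = -g z) : ∫ z, g z ∂noiseDiffLaw P = 0 := by
  have h := integral_noiseDiffLaw_neg hP hg.stronglyMeasurable
  simp only [hodd, integral_neg] at h
  linarith

theorem denoised_eq_integral {Ψ : Vec d → Vec d} (hΨ : Measurable Ψ) (v : Vec d) :
    denoised P Ψ v = ∫ z, Ψ (v + z) ∂noiseDiffLaw P := by
  have hm : Measurable fun z => Ψ (v + z) := hΨ.comp (measurable_const_add v)
  rw [noiseDiffLaw, integral_map (by fun_prop) hm.aestronglyMeasurable]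
  rfl

end Noise

/-! ### Slabs and the gain of an integral under translation. -/

section Slab

variable {d : ℕ} {u : Vec d} {ρ : ℝ}

/-- The part of a cylinder of radius `ρ` around the axis `u` at heights in `(a, b]`. -/
def slab {d : ℕ} (u : Vec d) (ρ a b : ℝ) : Set (Vec d) :=
  {z | a < inner ℝ z u ∧ inner ℝ z u ≤ b ∧ ‖z - (inner ℝ z u : ℝ) • u‖ ≤ ρ}

theorem measurableSet_slab (u : Vec d) (ρ a b : ℝ) : MeasurableSet (slab u ρ a b) := by
  have h : Measurable fun z : Vec d => (inner ℝ z u : ℝ) := by fun_prop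
  have h' : Measurable fun z : Vec d => ‖z - (inner ℝ z u : ℝ) • u‖ := by fun_prop
  exact (measurableSet_lt measurable_const h).inter
    ((measurableSet_le h measurable_const).inter (measurableSet_le h' measurable_const))

theorem inner_add_smul_self (hu : ‖u‖ = 1) (z : Vec d) (r : ℝ) :
    inner ℝ (z + r • u) u = (inner ℝ z u : ℝ) + r := by
  rw [inner_add_left, real_inner_smul_left, real_inner_self_eq_norm_sq, hu]
  ring

theorem perp_add_smul_self (hu : ‖u‖ = 1) (z : Vec d) (r : ℝ) :
    z + r • u - (inner ℝ (z + r • u) u : ℝ) • u = z - (inner ℝ z u : ℝ) • u := by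
  rw [inner_add_smul_self hu, add_smul]
  abel

theorem preimage_add_slab (hu : ‖u‖ = 1) (a b r : ℝ) :
    (fun z => z + r • u) ⁻¹' slab u ρ (a + r) (b + r) = slab u ρ a b := by
  ext z
  simp only [slab, Set.mem_preimage, Set.mem_ofPred_eq, perp_add_smul_self hu]
  simp only [inner_add_smul_self hu, add_lt_add_iff_right, add_le_add_iff_right]

theorem norm_le_of_mem_slab (hu : ‖u‖ = 1) {a b : ℝ} {z : Vec d} (hz : z ∈ slab u ρ a b) :
    ‖z‖ ≤ |(inner ℝ z u : ℝ)| + ρ := by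
  calc ‖z‖ = ‖(inner ℝ z u : ℝ) • u + (z - (inner ℝ z u : ℝ) • u)‖ := by congr 1; abel
    _ ≤ ‖(inner ℝ z u : ℝ) • u‖ + ‖z - (inner ℝ z u : ℝ) • u‖ := norm_add_le _ _
    _ ≤ _ := by
      rw [norm_smul, hu, mul_one, Real.norm_eq_abs]
      gcongr
      exact hz.2.2

theorem slab_subset_closedBall (hu : ‖u‖ = 1) {a b R : ℝ} (ha : -R ≤ a) (hb : b ≤ R) :
    slab u ρ a b ⊆ Metric.closedBall 0 (R + ρ) := fun z hz => by
  rw [mem_closedBall_zero_iff]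
  refine (norm_le_of_mem_slab hu hz).trans ?_
  gcongr
  exact abs_le.2 ⟨ha.trans hz.1.le, hz.2.1.trans hb⟩

theorem volume_slab_ne_top (hu : ‖u‖ = 1) (a b : ℝ) : volume (slab u ρ a b) ≠ ∞ := by
  have h : slab u ρ a b ⊆ Metric.closedBall 0 (max |a| |b| + ρ) :=
    slab_subset_closedBall hu
      ((neg_le_neg (le_max_left _ _)).trans (neg_abs_le a)) ((le_abs_self b).trans (le_max_right _ _))
  exact ((measure_mono h).trans_lt measure_closedBall_lt_top).ne

theorem setIntegral_slab_add (hu : ‖u‖ = 1) (h : Vec d → ℝ) (a b r : ℝ) :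
    ∫ z in slab u ρ a b, h (z + r • u) = ∫ z in slab u ρ (a + r) (b + r), h z := by
  rw [← preimage_add_slab hu a b r]
  exact (measurePreserving_add_right volume (r • u)).setIntegral_preimage_emb
    (measurableEmbedding_addRight _) h _

theorem volume_slab_add (hu : ‖u‖ = 1) (a b r : ℝ) :
    volume (slab u ρ (a + r) (b + r)) = volume (slab u ρ a b) := by
  rw [← preimage_add_slab hu a b r]
  exact (measure_preimage_add_right volume (r • u) _).symm

theorem slab_subset_union (a b c : ℝ) :
    slab u ρ a c ⊆ slab u ρ a b ∪ slab u ρ b c := fun z hz => by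
  rcases le_or_gt (inner ℝ z u) b with h | h
  · exact Or.inl ⟨hz.1, h, hz.2.2⟩
  · exact Or.inr ⟨h, hz.2.1, hz.2.2⟩

/-- A slab of height `n * r` is covered by `n` stacked translates of the slab of height `r`. -/
theorem volume_slab_nat_mul_le (hu : ‖u‖ = 1) (r : ℝ) (n : ℕ) :
    volume.real (slab u ρ 0 (n * r)) ≤ n * volume.real (slab u ρ 0 r) := by
  induction n with
  | zero =>
    have : slab u ρ 0 ((0 : ℕ) * r) = ∅ := by
      ext z
      simp only [slab, Set.mem_ofPred_eq, Nat.cast_zero, zero_mul, Set.mem_empty_iff_false,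
        iff_false]
      rintro ⟨h1, h2, -⟩
      linarith
    rw [this]
    simp
  | succ n ih =>
    have h1 : volume.real (slab u ρ (n * r) ((n + 1 : ℕ) * r)) = volume.real (slab u ρ 0 r) := by
      have := volume_slab_add (ρ := ρ) hu 0 r (n * r)
      rw [Measure.real, Measure.real, ← this]
      congr 3 <;> push_cast <;> ring
    calc volume.real (slab u ρ 0 ((n + 1 : ℕ) * r))
        ≤ volume.real (slab u ρ 0 (n * r) ∪ slab u ρ (n * r) ((n + 1 : ℕ) * r)) :=
          measureReal_mono (slab_subset_union _ _ _)
            (measure_union_ne_top (volume_slab_ne_top hu _ _) (volume_slab_ne_top hu _ _))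
      _ ≤ _ := measureReal_union_le _ _
      _ ≤ n * volume.real (slab u ρ 0 r) + volume.real (slab u ρ 0 r) := by rw [h1]; gcongr
      _ = _ := by push_cast; ring

/-- Thin slabs have volume at least proportional to their height, uniformly in the axis. -/
theorem le_volume_slab (hu : ‖u‖ = 1) {r : ℝ} (hr : 0 < r) (hrρ : r ≤ ρ) :
    volume.real (Metric.ball (0 : Vec d) (ρ / 2)) / (2 * ρ) * r ≤ volume.real (slab u ρ 0 r) := by
  have hρ : 0 < ρ := hr.trans_le hrρ
  -- The ball of radius `ρ / 2` centred at `(ρ / 2) • u` fits in the slab, and its volume does not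
  -- depend on `u`.
  have hball : volume.real (Metric.ball (0 : Vec d) (ρ / 2)) ≤ volume.real (slab u ρ 0 ρ) := by
    have hc : volume (Metric.ball (0 : Vec d) (ρ / 2)) =
        volume (Metric.ball ((ρ / 2) • u) (ρ / 2)) :=
      (Measure.addHaar_ball_center volume _ _).symm
    rw [Measure.real, hc]
    refine measureReal_mono (fun z hz => ?_) (volume_slab_ne_top hu _ _)
    obtain ⟨w, rfl⟩ : ∃ w, z = w + (ρ / 2) • u := ⟨z - (ρ / 2) • u, by abel⟩
    rw [mem_ball_iff_norm, add_sub_cancel_right] at hz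
    have hin : |(inner ℝ w u : ℝ)| ≤ ‖w‖ := by
      simpa [hu] using abs_real_inner_le_norm w u
    have hin' := abs_le.1 hin
    have hs := inner_add_smul_self hu w (ρ / 2)
    refine ⟨by rw [hs]; linarith, by rw [hs]; linarith, ?_⟩
    rw [perp_add_smul_self hu]
    calc ‖w - (inner ℝ w u : ℝ) • u‖ ≤ ‖w‖ + ‖(inner ℝ w u : ℝ) • u‖ := norm_sub_le _ _
      _ = ‖w‖ + |(inner ℝ w u : ℝ)| := by rw [norm_smul, hu, mul_one, Real.norm_eq_abs]
      _ ≤ ρ := by linarith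
  have hn1 : ρ ≤ ⌈ρ / r⌉₊ * r := by
    rw [← div_le_iff₀ hr]; exact Nat.le_ceil _
  have hn2 : (⌈ρ / r⌉₊ : ℝ) ≤ 2 * ρ / r := by
    have h1 := (Nat.ceil_lt_add_one (div_pos hρ hr).le).le
    have h2 : 1 ≤ ρ / r := (one_le_div hr).2 hrρ
    calc (⌈ρ / r⌉₊ : ℝ) ≤ ρ / r + 1 := h1
      _ ≤ ρ / r + ρ / r := by gcongr
      _ = _ := by ring
  have key : volume.real (slab u ρ 0 ρ) ≤ 2 * ρ / r * volume.real (slab u ρ 0 r) :=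
    calc volume.real (slab u ρ 0 ρ) ≤ volume.real (slab u ρ 0 (⌈ρ / r⌉₊ * r)) :=
          measureReal_mono (fun z hz => ⟨hz.1, hz.2.1.trans hn1, hz.2.2⟩)
            (volume_slab_ne_top hu _ _)
      _ ≤ _ := volume_slab_nat_mul_le hu r _
      _ ≤ _ := by gcongr
  have := hball.trans key
  rw [div_mul_eq_mul_div, div_le_iff₀ (by positivity)]
  rw [div_mul_eq_mul_div, le_div_iff₀ hr] at this
  linarith

/-- For a bounded function that is nonpositive below the hyperplane `u^⊥` and at least `m` on the
slab at heights `(ρ, 2ρ]`, the integral over a slab grows linearly under translation along `u`. -/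
theorem le_integral_slab_sub (hu : ‖u‖ = 1) {h : Vec d → ℝ} (hm : Measurable h) {B : ℝ}
    (hB : ∀ z, |h z| ≤ B) (hneg : ∀ z, (inner ℝ z u : ℝ) ≤ 0 → h z ≤ 0) {m : ℝ} (hm0 : 0 ≤ m)
    (hlow : ∀ z ∈ slab u ρ ρ (2 * ρ), m ≤ h z) {r : ℝ} (hr : 0 < r) (hrρ : r ≤ ρ) :
    volume.real (Metric.ball (0 : Vec d) (ρ / 2)) / (2 * ρ) * m * r ≤
      ∫ z in slab u ρ (-ρ) ρ, (h (z + r • u) - h z) := by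
  have hρ : 0 < ρ := hr.trans_le hrρ
  have hint : ∀ (g : Vec d → ℝ), Measurable g → (∀ z, |g z| ≤ B) → ∀ a b : ℝ,
      IntegrableOn g (slab u ρ a b) := fun g hg hgB a b =>
    Measure.integrableOn_of_bounded (M := B) (volume_slab_ne_top hu a b) hg.aestronglyMeasurable
      (Filter.Eventually.of_forall hgB)
  have hsplit : ∀ a b c : ℝ, a ≤ b → b ≤ c →
      ∫ z in slab u ρ a c, h z = (∫ z in slab u ρ a b, h z) + ∫ z in slab u ρ b c, h z := by
    intro a b c hab hbc
    have hU : slab u ρ a c = slab u ρ a b ∪ slab u ρ b c := by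
      refine (slab_subset_union a b c).antisymm (Set.union_subset ?_ ?_)
      · exact fun z hz => ⟨hz.1, hz.2.1.trans hbc, hz.2.2⟩
      · exact fun z hz => ⟨hab.trans_lt hz.1, hz.2.1, hz.2.2⟩
    rw [hU]
    refine setIntegral_union ?_ (measurableSet_slab _ _ _ _) (hint h hm hB _ _) (hint h hm hB _ _)
    exact Set.disjoint_left.2 fun z hz hz' => absurd hz'.1 (not_lt.2 hz.2.1)
  have hshift : Measurable fun z => h (z + r • u) := hm.comp (measurable_add_const _)
  -- The common heights `(-ρ + r, ρ]` cancel. What remains is the layer `(ρ, ρ + r]`, where `h ≥ m`,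
  -- minus the layer `(-ρ, -ρ + r]`, where `h ≤ 0`; both use `r ≤ ρ`.
  rw [integral_sub (hint _ hshift (fun z => hB _) _ _) (hint h hm hB _ _), setIntegral_slab_add hu,
    hsplit (-ρ + r) ρ (ρ + r) (by linarith) (by linarith),
    hsplit (-ρ) (-ρ + r) ρ (by linarith) (by linarith)]
  have h1 : ∫ z in slab u ρ (-ρ) (-ρ + r), h z ≤ 0 :=
    setIntegral_nonpos (measurableSet_slab _ _ _ _) fun z hz =>
      hneg z (hz.2.1.trans (by linarith))
  have h2 : m * volume.real (slab u ρ 0 r) ≤ ∫ z in slab u ρ ρ (ρ + r), h z := by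
    have hv : volume.real (slab u ρ 0 r) = volume.real (slab u ρ ρ (ρ + r)) := by
      have := volume_slab_add (ρ := ρ) hu 0 r ρ
      rw [zero_add, add_comm r] at this
      rw [Measure.real, Measure.real, this]
    rw [hv]
    refine setIntegral_ge_of_const_le_real (measurableSet_slab _ _ _ _) (volume_slab_ne_top hu _ _)
      (fun z hz => hlow z ⟨hz.1, hz.2.1.trans (by linarith), hz.2.2⟩) (hint h hm hB _ _)
  have h3 := mul_le_mul_of_nonneg_left (le_volume_slab hu hr hrρ) hm0
  linarith

end Slab

/-- Averaging over the noise turns weak monotonicity along `u` into linear growth, with a slope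
that is uniform in the direction `u` and in the function. -/
theorem IsPDF.exists_linear_growth {d : ℕ} {P : Vec d → ℝ} (hP : IsPDF P) :
    ∃ ρ : ℝ, 0 < ρ ∧ ∃ c : ℝ, 0 < c ∧ ∀ (u : Vec d) (h : Vec d → ℝ) (B m : ℝ), ‖u‖ = 1 →
      Measurable h → (∀ z, |h z| ≤ B) → (∀ z, h (-z) = -h z) →
      (∀ z (r : ℝ), 0 ≤ r → h z ≤ h (z + r • u)) →
      (∀ z, (inner ℝ z u : ℝ) ≤ 0 → h z ≤ 0) → 0 ≤ m → (∀ z ∈ slab u ρ ρ (2 * ρ), m ≤ h z) →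
      ∀ r : ℝ, 0 ≤ r → c * m * min r ρ ≤ ∫ z, h (r • u + z) ∂noiseDiffLaw P := by
  have := isProbabilityMeasure_noiseDiffLaw hP
  obtain ⟨R, hR, c, hc, hctop, hle⟩ := hP.exists_smul_restrict_ball_le
  have hρ : 0 < R / 3 := by positivity
  -- The slab of radius `ρ` at heights `(-ρ, ρ]` lies in the closed ball of radius `2ρ`, hence
  -- inside the ball of radius `R`.
  set ρ := R / 3 with hρdef
  have hvol : 0 < volume.real (Metric.ball (0 : Vec d) (ρ / 2)) :=
    ENNReal.toReal_pos (Metric.measure_ball_pos _ _ (by positivity)).ne' measure_ball_lt_top.ne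
  refine ⟨ρ, hρ, c.toReal * (volume.real (Metric.ball (0 : Vec d) (ρ / 2)) / (2 * ρ)),
    mul_pos (ENNReal.toReal_pos hc.ne' hctop) (by positivity), ?_⟩
  intro u h B m hu hm hB hodd hmono hneg hm0 hlow r hr
  have hintg : ∀ g : Vec d → Vec d, Measurable g → Integrable (fun z => h (g z)) (noiseDiffLaw P) :=
    fun g hg => Integrable.of_bound (hm.comp hg).aestronglyMeasurable B
      (Filter.Eventually.of_forall fun z => hB _)
  -- only the displacement up to `ρ` is used
  set r' := min r ρ with hr'
  have hr'0 : 0 ≤ r' := le_min hr hρ.le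
  have hstep : ∫ z, h (r' • u + z) ∂noiseDiffLaw P ≤ ∫ z, h (r • u + z) ∂noiseDiffLaw P := by
    refine integral_mono (hintg _ (by fun_prop)) (hintg _ (by fun_prop)) fun z => ?_
    have := hmono (r' • u + z) (r - r') (sub_nonneg.2 (min_le_left _ _))
    refine this.trans_eq (congrArg h ?_)
    rw [sub_smul]; abel
  refine le_trans ?_ hstep
  -- Subtracting this zero turns the integrand into a nonnegative increment, so the noise law may be
  -- replaced by any smaller measure.
  have hzero := integral_noiseDiffLaw_of_odd hP hm hodd
  have hsub : ∫ z, h (r' • u + z) ∂noiseDiffLaw P =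
      ∫ z, (h (z + r' • u) - h z) ∂noiseDiffLaw P := by
    rw [integral_sub (hintg (· + r' • u) (by fun_prop)) (hintg (fun z => z) measurable_id),
      hzero, sub_zero]
    simp only [add_comm]
  rw [hsub]
  rcases hr'0.eq_or_lt with h0 | hpos
  · simp [← h0]
  have hslab := le_integral_slab_sub hu hm hB hneg hm0 hlow hpos (min_le_right _ _)
  have hsubset : slab u ρ (-ρ) ρ ⊆ Metric.ball 0 R :=
    (slab_subset_closedBall hu le_rfl le_rfl).trans
      (Metric.closedBall_subset_ball (by rw [hρdef]; linarith))
  have hle' : c • volume.restrict (slab u ρ (-ρ) ρ) ≤ noiseDiffLaw P := by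
    refine le_trans ?_ hle
    exact smul_le_smul_left c (Measure.restrict_mono_set _ hsubset)
  calc c.toReal * (volume.real (Metric.ball (0 : Vec d) (ρ / 2)) / (2 * ρ)) * m * r'
      = c.toReal * (volume.real (Metric.ball (0 : Vec d) (ρ / 2)) / (2 * ρ) * m * r') := by ring
    _ ≤ c.toReal * ∫ z in slab u ρ (-ρ) ρ, (h (z + r' • u) - h z) := by gcongr
    _ = ∫ z, (h (z + r' • u) - h z) ∂(c • volume.restrict (slab u ρ (-ρ) ρ)) := by
        rw [integral_smul_measure, smul_eq_mul]
    _ ≤ _ := integral_mono_measure hle'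
        (Filter.Eventually.of_forall fun z => sub_nonneg.2 (hmono z r' hr'0))
        ((hintg (· + r' • u) (by fun_prop)).sub (hintg (fun z => z) measurable_id))

/-! ### The drift bound for both forms of the nonlinearity. -/

section Nonlinearity

variable {d : ℕ} {P : Vec d → ℝ} {Ψ : Vec d → Vec d}

theorem IsComponentMap.map_zero {ψ : ℝ → ℝ} (hψ : IsComponentMap ψ) : ψ 0 = 0 := by
  have := hψ.odd 0
  rw [neg_zero] at this
  linarith

/-- If `ψ s = 0`, monotonicity and oddness make `ψ` vanish on `(-s, s)`, against either alternative
of nondegeneracy. -/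
theorem IsComponentMap.pos {ψ : ℝ → ℝ} (hψ : IsComponentMap ψ) {s : ℝ} (hs : 0 < s) :
    0 < ψ s := by
  have hnn : 0 ≤ ψ s := hψ.map_zero ▸ hψ.monotone hs.le
  refine hnn.lt_of_ne fun h0 => ?_
  have hzero : ∀ x ∈ Set.Ioo (-s) s, ψ x = 0 := fun x hx => by
    have h1 : ψ x ≤ 0 := h0 ▸ hψ.monotone hx.2.le
    have h2 : -ψ s ≤ ψ x := hψ.odd s ▸ hψ.monotone hx.1.le
    rw [← h0, neg_zero] at h2
    exact h1.antisymm h2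
  rcases hψ.nondegenerate with h | ⟨c, hc, hmono⟩
  · refine h ?_
    have : ψ =ᶠ[nhds 0] fun _ => 0 := by
      filter_upwards [Ioo_mem_nhds (neg_neg_of_pos hs) hs] with x hx using hzero x hx
    exact continuousAt_const.congr this.symm
  · have hlt : (0 : ℝ) < min s c / 2 := by positivity
    have hle : min s c / 2 < min s c := half_lt_self (by positivity)
    have h1 := hmono (a := 0) (b := min s c / 2) ⟨by linarith, hc⟩
      ⟨by linarith, hle.trans_le (min_le_right _ _)⟩ hlt
    rw [hψ.map_zero, hzero _ ⟨by linarith, hle.trans_le (min_le_left _ _)⟩] at h1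
    exact lt_irrefl _ h1

theorem IsRadialFactor.measurable {φ : ℝ → ℝ} (hφ : IsRadialFactor d φ) :
    Measurable fun x : Vec d => φ ‖x‖ • x := by
  -- Extended by zero, `a * φ a` is monotone, hence Borel; the nonlinearity is `g ‖x‖` times the
  -- direction of `x`.
  set g : ℝ → ℝ := fun a => if 0 < a then a * φ a else 0 with hg
  have hmono : Monotone g := fun a b hab => by
    rcases lt_or_ge 0 a with ha | ha
    · simpa [hg, ha, ha.trans_le hab] using hφ.monotoneOn_mul ha (ha.trans_le hab) hab
    · simp only [hg, not_lt.2 ha, if_false]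
      split_ifs with hb
      · exact mul_nonneg hb.le (hφ.pos b hb).le
      · exact le_rfl
  have hm : Measurable fun x : Vec d => g ‖x‖ • (‖x‖⁻¹ • x) := by
    have := hmono.measurable.comp (measurable_norm (α := Vec d))
    exact this.smul (by fun_prop)
  convert hm using 2 with x
  rcases eq_or_ne x 0 with rfl | hx
  · simp
  · have hx' : 0 < ‖x‖ := norm_pos_iff.2 hx
    simp only [hg, hx', if_true, smul_smul]
    congr 1
    field_simp

theorem IsAdmissibleNonlinearity.measurable (hΨ : IsAdmissibleNonlinearity Ψ) : Measurable Ψ := by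
  rcases hΨ with ⟨ψ, hψ, h⟩ | ⟨φ, hφ, h⟩
  · have hm : Measurable fun x : Vec d => WithLp.toLp 2 fun i => ψ (x i) := by
      have h1 : ∀ i, Measurable fun x : Vec d => ψ (x i) := fun i =>
        hψ.monotone.measurable.comp (by fun_prop)
      have h2 : Measurable fun x : Vec d => fun i => ψ (x i) := measurable_pi_lambda _ h1
      exact (WithLp.measurable_toLp 2 _).comp h2
    convert hm using 1
    ext x i
    exact h x i
  · rw [funext h]
    exact hφ.measurable

theorem integrable_of_norm_le {α E : Type*} [MeasurableSpace α] [NormedAddCommGroup E]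
    [MeasurableSpace E] [BorelSpace E] [SecondCountableTopology E] {μ : Measure α}
    [IsFiniteMeasure μ] {g : α → E} (hg : Measurable g) {C : ℝ} (hC : ∀ x, ‖g x‖ ≤ C) :
    Integrable g μ :=
  Integrable.of_bound hg.aestronglyMeasurable C (Filter.Eventually.of_forall hC)

theorem inner_denoised (hP : IsPDF P) (hm : Measurable Ψ) {C : ℝ} (hC : ∀ u, ‖Ψ u‖ ≤ C)
    (v w : Vec d) : inner ℝ (denoised P Ψ v) w = ∫ z, inner ℝ (Ψ (v + z)) w ∂noiseDiffLaw P := by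
  have := isProbabilityMeasure_noiseDiffLaw hP
  have hm' : Measurable fun z => Ψ (v + z) := hm.comp (measurable_const_add v)
  rw [denoised_eq_integral hm, real_inner_comm,
    ← integral_inner (integrable_of_norm_le hm' fun z => hC _)]
  simp only [real_inner_comm]

/-- A drift of at least `k ‖v‖ min (‖v‖, ρ)` yields denoising constants. -/
theorem areDenoisingConstants_of_le {k ρ : ℝ} (hk : 0 < k) (hρ : 0 < ρ)
    (h : ∀ v : Vec d, k * min ‖v‖ ρ * ‖v‖ ≤ inner ℝ (denoised P Ψ v) v) :
    AreDenoisingConstants P Ψ (k * ρ) k := by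
  refine ⟨by positivity, hk, fun v => le_trans ?_ (h v)⟩
  rcases min_cases ‖v‖ ρ with ⟨h1, -⟩ | ⟨h1, -⟩ <;> rw [h1]
  · exact (min_le_right _ _).trans_eq (by ring)
  · exact min_le_left _ _

/-- The inner product splits into coordinates, each covered by linear growth along a coordinate
vector with `m = ψ ρ`. Oddness handles negative coordinates. -/
theorem exists_denoisingConstants_component (hP : IsPDF P) {ψ : ℝ → ℝ} (hψ : IsComponentMap ψ)
    (hΨ : ∀ (x : Vec d) (i : Fin d), Ψ x i = ψ (x i)) (hm : Measurable Ψ) :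
    ∃ γ₁ γ₂ : ℝ, AreDenoisingConstants P Ψ γ₁ γ₂ := by
  have := isProbabilityMeasure_noiseDiffLaw hP
  obtain ⟨ρ, hρ, c, hc, hgrow⟩ := hP.exists_linear_growth
  obtain ⟨B, hB0, hB⟩ := hψ.bounded
  have hψm := hψ.monotone.measurable
  have hmρ := hψ.pos hρ
  have hmi : ∀ i, Measurable fun z : Vec d => ψ (z i) := fun i => hψm.comp (by fun_prop)
  have hmis : ∀ i (s : ℝ), Measurable fun z : Vec d => ψ (s + z i) := fun i s =>
    hψm.comp (by fun_prop)
  have hpos : ∀ (i : Fin d) (s : ℝ), 0 ≤ s →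
      c * ψ ρ * min s ρ ≤ ∫ z, ψ (s + z i) ∂noiseDiffLaw P := by
    intro i s hs
    have hin : ∀ z : Vec d, inner ℝ z (EuclideanSpace.single i (1 : ℝ)) = z i := fun z => by
      simp [EuclideanSpace.inner_single_right]
    have := hgrow (EuclideanSpace.single i 1) (fun z => ψ (z i)) B (ψ ρ) (by simp) (hmi i)
      (fun z => hB _) (fun z => by simpa using hψ.odd (z i))
      (fun z r hr => hψ.monotone (by simpa using hr))
      (fun z hz => by rw [hin] at hz; exact hψ.map_zero ▸ hψ.monotone hz) hmρ.le
      (fun z hz => hψ.monotone (by have := hz.1; rw [hin] at this; exact this.le)) s hs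
    simpa using this
  have habs : ∀ (i : Fin d) (s : ℝ),
      c * ψ ρ * min |s| ρ * |s| ≤ (∫ z, ψ (s + z i) ∂noiseDiffLaw P) * s := by
    intro i s
    rcases le_total 0 s with hs | hs
    · rw [abs_of_nonneg hs]
      exact mul_le_mul_of_nonneg_right (hpos i s hs) hs
    · have hneg : ∫ z, ψ (s + z i) ∂noiseDiffLaw P = -∫ z, ψ (-s + z i) ∂noiseDiffLaw P := by
        rw [← integral_noiseDiffLaw_neg hP (hmis i s).stronglyMeasurable, ← integral_neg]
        refine integral_congr_ae (Filter.Eventually.of_forall fun z => ?_)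
        simp only [PiLp.neg_apply]
        rw [← hψ.odd]
        congr 1
        ring
      rw [abs_of_nonpos hs, hneg]
      have := mul_le_mul_of_nonneg_right (hpos i (-s) (by linarith)) (neg_nonneg.2 hs)
      linarith
  have hbound : ∀ u, ‖Ψ u‖ ≤ √(∑ _i : Fin d, B ^ 2) := fun u => by
    rw [EuclideanSpace.norm_eq]
    gcongr with i
    rw [hΨ]
    exact hB _
  have hk : 0 < c * ψ ρ / 2 := by positivity
  refine ⟨_, _, areDenoisingConstants_of_le hk hρ fun v => ?_⟩
  have hsum : inner ℝ (denoised P Ψ v) v =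
      ∑ i, (∫ z, ψ (v i + z i) ∂noiseDiffLaw P) * v i := by
    rw [inner_denoised hP hm hbound]
    simp only [PiLp.inner_apply, hΨ, RCLike.inner_apply, conj_trivial, PiLp.add_apply]
    rw [integral_finsetSum]
    · refine Finset.sum_congr rfl fun i _ => ?_
      rw [← integral_mul_const]
      simp only [mul_comm]
    · exact fun i _ => (integrable_of_norm_le (hmis i (v i)) fun z => hB _).const_mul _
  rw [hsum]
  have hden : 0 < ρ + ‖v‖ := by positivity
  have hterm : ∀ i, c * ψ ρ * (ρ / (ρ + ‖v‖)) * v i ^ 2 ≤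
      (∫ z, ψ (v i + z i) ∂noiseDiffLaw P) * v i := fun i => by
    refine le_trans ?_ (habs i (v i))
    have hvi : |v i| ≤ ‖v‖ := by simpa using PiLp.norm_apply_le v i
    -- A factor common to all coordinates lets the squares add up to `‖v‖ ^ 2`, with no loss
    -- depending on the dimension.
    have : ρ / (ρ + ‖v‖) * |v i| ≤ min |v i| ρ := by
      rw [div_mul_eq_mul_div, div_le_iff₀ hden]
      have h0 := abs_nonneg (v i)
      rcases min_cases |v i| ρ with ⟨h1, -⟩ | ⟨h1, -⟩ <;> rw [h1] <;> nlinarith [norm_nonneg v]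
    calc c * ψ ρ * (ρ / (ρ + ‖v‖)) * v i ^ 2
        = c * ψ ρ * (ρ / (ρ + ‖v‖) * |v i|) * |v i| := by rw [← sq_abs]; ring
      _ ≤ _ := by gcongr
  refine le_trans ?_ (Finset.sum_le_sum fun i _ => hterm i)
  rw [← Finset.mul_sum]
  have hnorm : ∑ i, v i ^ 2 = ‖v‖ ^ 2 := by
    rw [EuclideanSpace.norm_sq_eq]
    simp
  rw [hnorm]
  have : min ‖v‖ ρ / 2 ≤ ρ / (ρ + ‖v‖) * ‖v‖ := by
    rw [div_mul_eq_mul_div, le_div_iff₀ hden]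
    have h0 := norm_nonneg v
    rcases min_cases ‖v‖ ρ with ⟨h1, h2⟩ | ⟨h1, h2⟩ <;> rw [h1] <;> nlinarith
  calc c * ψ ρ / 2 * min ‖v‖ ρ * ‖v‖ = c * ψ ρ * (min ‖v‖ ρ / 2) * ‖v‖ := by ring
    _ ≤ c * ψ ρ * (ρ / (ρ + ‖v‖) * ‖v‖) * ‖v‖ := by gcongr
    _ = _ := by ring

/-- Adding a nonnegative multiple of a unit vector `u` does not decrease the component of a joint
nonlinearity along `u`. -/
theorem IsRadialFactor.inner_mono {φ : ℝ → ℝ} (hφ : IsRadialFactor d φ) {u : Vec d}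
    (hu : ‖u‖ = 1) (z : Vec d) {r : ℝ} (hr : 0 ≤ r) :
    inner ℝ (φ ‖z‖ • z) u ≤ (inner ℝ (φ ‖z + r • u‖ • (z + r • u)) u : ℝ) := by
  have hin : ∀ z : Vec d, |(inner ℝ z u : ℝ)| ≤ ‖z‖ := fun z => by
    simpa [hu] using abs_real_inner_le_norm z u
  have hsgn : ∀ z : Vec d, 0 ≤ (inner ℝ z u : ℝ) → 0 ≤ φ ‖z‖ * inner ℝ z u := fun z hz => by
    rcases (norm_nonneg z).eq_or_lt with h0 | h0
    · rw [norm_eq_zero.1 h0.symm]; simp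
    · exact mul_nonneg (hφ.pos _ h0).le hz
  -- For `⟨z, u⟩ > 0`, the component is `‖z‖ φ(‖z‖)` times the cosine of the angle to `u`; both
  -- factors are non-decreasing under translation along `u`.
  have hhalf : ∀ (z : Vec d) (r : ℝ), 0 ≤ r → 0 ≤ (inner ℝ z u : ℝ) →
      φ ‖z‖ * inner ℝ z u ≤ φ ‖z + r • u‖ * ((inner ℝ z u : ℝ) + r) := by
    intro z r hr hs
    rcases hs.eq_or_lt with hs0 | hs0
    · have := hsgn (z + r • u) (by rw [inner_add_smul_self hu]; positivity)
      rw [inner_add_smul_self hu] at this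
      rw [← hs0, mul_zero]
      simpa [← hs0] using this
    have ha : 0 < ‖z‖ := hs0.trans_le ((le_abs_self _).trans (hin z))
    have hsq : ‖z + r • u‖ ^ 2 = ‖z‖ ^ 2 + 2 * r * inner ℝ z u + r ^ 2 := by
      rw [norm_add_sq_real, real_inner_smul_right, norm_smul, hu, Real.norm_eq_abs, mul_one, sq_abs]
      ring
    have hab : ‖z‖ ≤ ‖z + r • u‖ := by
      refine (sq_le_sq₀ (norm_nonneg _) (norm_nonneg _)).1 ?_
      rw [hsq]
      nlinarith [mul_nonneg hr hs]
    have hb : 0 < ‖z + r • u‖ := ha.trans_le hab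
    have hratio : inner ℝ z u / ‖z‖ ≤ ((inner ℝ z u : ℝ) + r) / ‖z + r • u‖ := by
      rw [div_le_div_iff₀ ha hb]
      refine (sq_le_sq₀ (by positivity) (by positivity)).1 ?_
      rw [mul_pow, mul_pow, hsq]
      have h1 : (inner ℝ z u : ℝ) ^ 2 ≤ ‖z‖ ^ 2 := by
        rw [← sq_abs]; exact pow_le_pow_left₀ (abs_nonneg _) (hin z) 2
      nlinarith [mul_le_mul_of_nonneg_left h1 (by positivity : 0 ≤ 2 * r * inner ℝ z u + r ^ 2)]
    calc φ ‖z‖ * inner ℝ z u = ‖z‖ * φ ‖z‖ * (inner ℝ z u / ‖z‖) := by field_simp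
      _ ≤ ‖z + r • u‖ * φ ‖z + r • u‖ * (((inner ℝ z u : ℝ) + r) / ‖z + r • u‖) :=
        mul_le_mul (hφ.monotoneOn_mul ha hb hab) hratio (by positivity)
          (mul_nonneg hb.le (hφ.pos _ hb).le)
      _ = _ := by field_simp
  simp only [real_inner_smul_left]
  rw [inner_add_smul_self hu]
  rcases le_total 0 (inner ℝ z u : ℝ) with hs | hs
  · exact hhalf z r hr hs
  have hnp : φ ‖z‖ * inner ℝ z u ≤ 0 := by
    have := hsgn (-z) (by simpa using hs)
    simpa using this
  rcases le_total 0 ((inner ℝ z u : ℝ) + r) with hs' | hs'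
  · have := hsgn (z + r • u) (by rwa [inner_add_smul_self hu])
    rw [inner_add_smul_self hu] at this
    exact hnp.trans this
  -- Both components are nonpositive here; reflection through the origin reduces this to moving from
  -- `-(z + r • u)` to `-z`.
  · have := hhalf (-(z + r • u)) r hr (by rw [inner_neg_left, inner_add_smul_self hu]; linarith)
    rw [inner_neg_left, inner_add_smul_self hu, norm_neg,
      show -(z + r • u) + r • u = -z by abel, norm_neg] at this
    linarith

/-- Linear growth is applied in the direction of `v`. On the slab at heights `(ρ, 2ρ]` the norm is
at most `3ρ`, so the component along `u` is at least `φ (3 * ρ) * ρ`. -/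
theorem exists_denoisingConstants_radial (hP : IsPDF P) {φ : ℝ → ℝ} (hφ : IsRadialFactor d φ)
    (hΨ : ∀ x : Vec d, Ψ x = φ ‖x‖ • x) (hm : Measurable Ψ) :
    ∃ γ₁ γ₂ : ℝ, AreDenoisingConstants P Ψ γ₁ γ₂ := by
  obtain ⟨ρ, hρ, c, hc, hgrow⟩ := hP.exists_linear_growth
  obtain ⟨B, hB0, hB⟩ := hφ.bounded
  have hbound : ∀ x, ‖Ψ x‖ ≤ B := fun x => by rw [hΨ]; exact hB x
  have hφρ : 0 < φ (3 * ρ) := hφ.pos _ (by positivity)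
  have hk : 0 < c * (φ (3 * ρ) * ρ) := by positivity
  refine ⟨_, _, areDenoisingConstants_of_le hk hρ fun v => ?_⟩
  rcases eq_or_ne v 0 with rfl | hv
  · simp
  have hv' : 0 < ‖v‖ := norm_pos_iff.2 hv
  have hu : ‖‖v‖⁻¹ • v‖ = 1 := by rw [norm_smul, norm_inv, norm_norm, inv_mul_cancel₀ hv'.ne']
  have hvu : ‖v‖ • ‖v‖⁻¹ • v = v := by rw [smul_smul, mul_inv_cancel₀ hv'.ne', one_smul]
  set u := ‖v‖⁻¹ • v with hudef
  have hin : ∀ z : Vec d, (inner ℝ z v : ℝ) = ‖v‖ * inner ℝ z u := fun z => by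
    rw [← real_inner_smul_right, hvu]
  have key := hgrow u (fun z => inner ℝ (Ψ z) u) B (φ (3 * ρ) * ρ) hu (by fun_prop)
    (fun z => (abs_real_inner_le_norm (Ψ z) u).trans (by rw [hu, mul_one]; exact hbound z))
    (fun z => by simp [hΨ])
    (fun z r hr => by simpa only [hΨ] using hφ.inner_mono hu z hr)
    -- Moving `z` along `u` up to the hyperplane `u^⊥`, where the component is zero, can only
    -- increase it.
    (fun z hz => by
      have := hφ.inner_mono hu z (r := -inner ℝ z u) (by linarith)
      simp only [real_inner_smul_left] at this
      rw [inner_add_smul_self hu, add_neg_cancel, mul_zero] at this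
      simpa only [hΨ, real_inner_smul_left] using this)
    (by positivity)
    (fun z hz => by
      have hpos : 0 < ‖z‖ := by
        refine norm_pos_iff.2 fun h0 => ?_
        have := hz.1
        rw [h0, inner_zero_left] at this
        linarith
      have hz3 : ‖z‖ ≤ 3 * ρ := by
        refine (norm_le_of_mem_slab hu hz).trans ?_
        rw [abs_of_pos (hρ.trans hz.1)]
        linarith [hz.2.1]
      rw [hΨ, real_inner_smul_left]
      exact mul_le_mul (hφ.antitoneOn hpos (by positivity : (0 : ℝ) < 3 * ρ) hz3) hz.1.le hρ.le
        (hφ.pos _ hpos).le) ‖v‖ hv'.le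
  rw [inner_denoised hP hm hbound]
  simp only [hin, integral_const_mul]
  rw [hvu] at key
  calc _ = ‖v‖ * (c * (φ (3 * ρ) * ρ) * min ‖v‖ ρ) := by ring
    _ ≤ _ := by gcongr

theorem exists_denoisingConstants (hP : IsPDF P) (hΨ : IsAdmissibleNonlinearity Ψ) :
    ∃ γ₁ γ₂ : ℝ, AreDenoisingConstants P Ψ γ₁ γ₂ := by
  have hm := hΨ.measurable
  rcases hΨ with ⟨ψ, hψ, h⟩ | ⟨φ, hφ, h⟩
  · exact exists_denoisingConstants_component hP hψ h hm
  · exact exists_denoisingConstants_radial hP hφ h hm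

end Nonlinearity

/-! ### Independence from the past and the exponential supermartingale. -/

section PastNoise

variable {d : ℕ} {Ω : Type*}

/-- The time at which a noise vector is drawn. -/
def noiseTime : ℕ+ ⊕ ℕ+ → ℕ := Sum.elim (fun k => k) fun k => k

/-- The σ-algebra generated by the noise vectors drawn at times in `s`. -/
abbrev noiseSigma (Z : ℕ+ ⊕ ℕ+ → Ω → Vec d) (s : Set ℕ) : MeasurableSpace Ω :=
  ⨆ i ∈ noiseTime ⁻¹' s, MeasurableSpace.comap (Z i) inferInstance

/-- The difference of the two noise vectors drawn at time `n + 1`. -/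
def noiseDiff (Z : ℕ+ ⊕ ℕ+ → Ω → Vec d) (n : ℕ) (ω : Ω) : Vec d :=
  Z (Sum.inl n.succPNat) ω - Z (Sum.inr n.succPNat) ω

theorem measurable_noiseSigma (Z : ℕ+ ⊕ ℕ+ → Ω → Vec d) {s : Set ℕ} {i : ℕ+ ⊕ ℕ+}
    (hi : noiseTime i ∈ s) : Measurable[noiseSigma Z s] (Z i) :=
  (comap_measurable (Z i)).mono
    (le_iSup₂_of_le (f := fun i (_ : i ∈ noiseTime ⁻¹' s) => MeasurableSpace.comap (Z i) _)
      i hi le_rfl) le_rfl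

theorem noiseSigma_mono (Z : ℕ+ ⊕ ℕ+ → Ω → Vec d) {s t : Set ℕ} (hst : s ⊆ t) :
    noiseSigma Z s ≤ noiseSigma Z t :=
  biSup_mono fun _ hi => hst hi

theorem measurable_noiseDiff (Z : ℕ+ ⊕ ℕ+ → Ω → Vec d) {s : Set ℕ} {n : ℕ} (hn : n + 1 ∈ s) :
    Measurable[noiseSigma Z s] (noiseDiff Z n) := by
  have h1 := measurable_noiseSigma Z (s := s) (i := Sum.inl n.succPNat) (by simpa [noiseTime])
  have h2 := measurable_noiseSigma Z (s := s) (i := Sum.inr n.succPNat) (by simpa [noiseTime])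
  have hsub : Measurable fun p : Vec d × Vec d => p.1 - p.2 := by fun_prop
  exact hsub.comp (h1.prodMk h2)

variable {P : Vec d → ℝ} [MeasurableSpace Ω] {μ : Measure Ω}

theorem noiseSigma_le {Z : ℕ+ ⊕ ℕ+ → Ω → Vec d} (hZ : ∀ i, Measurable (Z i)) (s : Set ℕ) :
    noiseSigma Z s ≤ ‹MeasurableSpace Ω› :=
  iSup₂_le fun i _ => (hZ i).comap_le

theorem indep_noiseSigma {Z : ℕ+ ⊕ ℕ+ → Ω → Vec d} (hZ : IsIIDWithPDF μ Z P) {s t : Set ℕ}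
    (hst : Disjoint s t) : Indep (noiseSigma Z s) (noiseSigma Z t) μ :=
  indep_iSup_of_disjoint (fun i => (hZ.measurable i).comap_le) hZ.indep (hst.preimage _)

theorem map_noiseDiff [IsProbabilityMeasure μ] {Z : ℕ+ ⊕ ℕ+ → Ω → Vec d}
    (hZ : IsIIDWithPDF μ Z P) (n : ℕ) : μ.map (noiseDiff Z n) = noiseDiffLaw P := by
  have hpair := (indepFun_iff_map_prod_eq_prod_map_map (hZ.measurable _).aemeasurable
    (hZ.measurable _).aemeasurable).1
    (hZ.indep.indepFun (i := Sum.inl n.succPNat) (j := Sum.inr n.succPNat) (by simp))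
  rw [hZ.law, hZ.law] at hpair
  rw [noiseDiffLaw, ← hpair, Measure.map_map (by fun_prop)
    ((hZ.measurable _).prodMk (hZ.measurable _))]
  rfl

theorem IndepFun.lintegral_comp_prod {β γ : Type*} [MeasurableSpace β] [MeasurableSpace γ]
    [IsProbabilityMeasure μ] {X : Ω → β} {W : Ω → γ} (hX : Measurable X) (hW : Measurable W)
    (h : IndepFun X W μ) {f : β × γ → ℝ≥0∞} (hf : Measurable f) :
    ∫⁻ ω, f (X ω, W ω) ∂μ = ∫⁻ ω, ∫⁻ w, f (X ω, w) ∂(μ.map W) ∂μ := by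
  have := Measure.isProbabilityMeasure_map (μ := μ) hW.aemeasurable
  rw [← lintegral_map (f := f) hf (hX.prodMk hW),
    (indepFun_iff_map_prod_eq_prod_map_map hX.aemeasurable hW.aemeasurable).1 h,
    lintegral_prod _ hf.aemeasurable, lintegral_map (hf.lintegral_prod_right') hX]

/-- If the conditional exponential moments of the increments are at most one, then so is the
exponential moment of their sum. -/
theorem lintegral_exp_sum_le_one [IsProbabilityMeasure μ] {Z : ℕ+ ⊕ ℕ+ → Ω → Vec d}
    (hZ : IsIIDWithPDF μ Z P) {q : ℕ → Vec d → Vec d → ℝ}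
    (hq : ∀ n, Measurable (Function.uncurry (q n))) {X : ℕ → Ω → Vec d}
    (hX : ∀ n, Measurable[noiseSigma Z (Set.Iic n)] (X n))
    (hle : ∀ n ω, ∫⁻ z, ENNReal.ofReal (Real.exp (q n (X n ω) z)) ∂noiseDiffLaw P ≤ 1) (n : ℕ) :
    ∫⁻ ω, ENNReal.ofReal (Real.exp (∑ k ∈ Finset.range n, q k (X k ω) (noiseDiff Z k ω))) ∂μ
      ≤ 1 := by
  induction n with
  | zero => simp
  | succ n ih =>
    set S : Ω → ℝ := fun ω => ∑ k ∈ Finset.range n, q k (X k ω) (noiseDiff Z k ω) with hS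
    have hSm : Measurable[noiseSigma Z (Set.Iic n)] S := by
      refine Finset.measurable_sum _ fun k hk => ?_
      rw [Finset.mem_range] at hk
      have h1 : Measurable[noiseSigma Z (Set.Iic n)] (X k) :=
        (hX k).mono (noiseSigma_mono Z (Set.Iic_subset_Iic.2 hk.le)) le_rfl
      have h2 : Measurable[noiseSigma Z (Set.Iic n)] (noiseDiff Z k) :=
        measurable_noiseDiff Z (Set.mem_Iic.2 hk)
      exact (hq k).comp (h1.prodMk h2)
    have hD : Measurable[noiseSigma Z {n + 1}] (noiseDiff Z n) := measurable_noiseDiff Z rfl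
    have hT : Measurable[noiseSigma Z (Set.Iic n)] fun ω => (X n ω, S ω) := (hX n).prodMk hSm
    -- The left side depends on noise up to time `n`, the right side on time `n + 1` only; the
    -- newest noise can thus be integrated out with the past frozen.
    have hind : IndepFun (fun ω => (X n ω, S ω)) (noiseDiff Z n) μ := by
      have := indep_noiseSigma hZ (s := Set.Iic n) (t := {n + 1}) (by simp)
      exact indep_of_indep_of_le_left (indep_of_indep_of_le_right this hD.comap_le) hT.comap_le
    have hf : Measurable fun p : (Vec d × ℝ) × Vec d =>
        ENNReal.ofReal (Real.exp (p.1.2 + q n p.1.1 p.2)) := by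
      have : Measurable fun p : (Vec d × ℝ) × Vec d => q n p.1.1 p.2 :=
        (hq n).comp (by fun_prop : Measurable fun p : (Vec d × ℝ) × Vec d => (p.1.1, p.2))
      fun_prop
    have hle' := noiseSigma_le hZ.measurable
    calc ∫⁻ ω, ENNReal.ofReal (Real.exp
          (∑ k ∈ Finset.range (n + 1), q k (X k ω) (noiseDiff Z k ω))) ∂μ
        = ∫⁻ ω, ENNReal.ofReal (Real.exp (S ω + q n (X n ω) (noiseDiff Z n ω))) ∂μ := by
          simp only [Finset.sum_range_succ, hS]
      _ = ∫⁻ ω, ∫⁻ z, ENNReal.ofReal (Real.exp (S ω + q n (X n ω) z)) ∂noiseDiffLaw P ∂μ := by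
          rw [← map_noiseDiff hZ n]
          exact IndepFun.lintegral_comp_prod (hT.mono (hle' _) le_rfl) (hD.mono (hle' _) le_rfl)
            hind hf
      _ ≤ ∫⁻ ω, ENNReal.ofReal (Real.exp (S ω)) ∂μ := by
          refine lintegral_mono fun ω => ?_
          have hqm : Measurable fun z => q n (X n ω) z := (hq n).comp measurable_prodMk_left
          simp only [Real.exp_add, ENNReal.ofReal_mul (Real.exp_pos _).le]
          rw [lintegral_const_mul _ (by fun_prop)]
          exact mul_le_of_le_one_right' (hle n ω)
      _ ≤ 1 := ih

/-- Markov's inequality for exponential moments. -/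
theorem ofReal_one_sub_le_measure_of_lintegral_exp_le_one [IsProbabilityMeasure μ] {S : Ω → ℝ}
    (hS : Measurable S) (h : ∫⁻ ω, ENNReal.ofReal (Real.exp (S ω)) ∂μ ≤ 1) {δ : ℝ} (hδ : 0 < δ) :
    ENNReal.ofReal (1 - δ) ≤ μ {ω | S ω < Real.log (1 / δ)} := by
  have hset : {ω | S ω < Real.log (1 / δ)} =
      {ω | ENNReal.ofReal (1 / δ) ≤ ENNReal.ofReal (Real.exp (S ω))}ᶜ := by
    ext ω
    simp only [Set.mem_compl_iff, Set.mem_ofPred_eq, not_le]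
    rw [Real.lt_log_iff_exp_lt (by positivity), ENNReal.ofReal_lt_ofReal_iff (by positivity)]
  have hm : Measurable fun ω => ENNReal.ofReal (Real.exp (S ω)) := by fun_prop
  have hmarkov := (mul_meas_ge_le_lintegral (μ := μ) hm (ENNReal.ofReal (1 / δ))).trans h
  rw [hset, prob_compl_eq_one_sub (measurableSet_le measurable_const hm),
    ENNReal.ofReal_sub _ hδ.le, ENNReal.ofReal_one]
  refine tsub_le_tsub_left ?_ 1
  rw [one_div, ENNReal.ofReal_inv_of_pos hδ] at hmarkov
  have hδ0 : ENNReal.ofReal δ ≠ 0 := by simpa using hδ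
  rw [one_div, ENNReal.ofReal_inv_of_pos hδ]
  have := mul_le_mul_right hmarkov (ENNReal.ofReal δ)
  rwa [← mul_assoc, ENNReal.mul_inv_cancel hδ0 ENNReal.ofReal_ne_top, one_mul, mul_one] at this

end PastNoise

/-! ### Descent inequality and exponential moment of one step. -/

section OneStep

variable {d : ℕ} {P : Vec d → ℝ} {Ψ : Vec d → Vec d}

/-- Quadratic upper bound for a function with Lipschitz gradient. -/
theorem IsSmoothCost.le_quadratic {F : Vec d → ℝ} {L : ℝ≥0} (hF : IsSmoothCost F L)
    (x v : Vec d) :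
    F (x + v) ≤ F x + inner ℝ (gradient F x) v + L / 2 * ‖v‖ ^ 2 := by
  have hderiv : ∀ t : ℝ, HasDerivAt (fun t : ℝ => F (x + t • v))
      (inner ℝ (gradient F (x + t • v)) v) t := fun t => by
    have h1 := (hF.differentiable (x + t • v)).hasGradientAt.hasFDerivAt
    have h2 : HasDerivAt (fun t : ℝ => x + t • v) v t := by
      simpa using ((hasDerivAt_id t).smul_const v).const_add x
    exact (h1.comp_hasDerivAt t h2).congr_deriv (by simp)
  have hB : ∀ t : ℝ, HasDerivAt
      (fun t : ℝ => F x + t * inner ℝ (gradient F x) v + L / 2 * ‖v‖ ^ 2 * t ^ 2)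
      (inner ℝ (gradient F x) v + L * ‖v‖ ^ 2 * t) t := fun t => by
    have h1 := ((hasDerivAt_id t).mul_const (inner ℝ (gradient F x) v)).const_add (F x)
    have h2 := ((hasDerivAt_id t).pow 2).const_mul ((L : ℝ) / 2 * ‖v‖ ^ 2)
    refine (h1.add h2).congr_deriv ?_
    simp
    ring
  -- On `[0, 1]` the function and its quadratic majorant agree at `0`, and their derivatives are
  -- ordered by the Lipschitz bound.
  have := image_le_of_deriv_right_le_deriv_boundary (a := 0) (b := 1)
    (fun t _ => (hderiv t).continuousAt.continuousWithinAt)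
    (fun t _ => (hderiv t).hasDerivWithinAt) (by simp)
    (fun t _ => (hB t).continuousAt.continuousWithinAt)
    (fun t _ => (hB t).hasDerivWithinAt) (fun t ht => ?_) (x := 1) (by simp)
  · simpa using this
  · have hlip := hF.lipschitz.dist_le_mul (x + t • v) x
    rw [dist_eq_norm, dist_eq_norm, add_sub_cancel_left, norm_smul, Real.norm_of_nonneg ht.1]
      at hlip
    have hcs := real_inner_le_norm (gradient F (x + t • v) - gradient F x) v
    rw [inner_sub_left] at hcs
    have := mul_le_mul_of_nonneg_right hlip (norm_nonneg v)
    linarith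

/-- Exponential moment of the drift of one step, by Hoeffding's lemma. -/
theorem lintegral_exp_drift_le (hP : IsPDF P) (hm : Measurable Ψ) {C : ℝ}
    (hC : ∀ u, ‖Ψ u‖ ≤ C) (g : Vec d) {α b : ℝ} (hα : 0 ≤ α)
    (hb : b ≤ inner ℝ (denoised P Ψ g) g) (hαb : α * C ^ 2 * ‖g‖ ^ 2 ≤ b) :
    ∫⁻ z, ENNReal.ofReal (Real.exp (α * b / 2 - α * inner ℝ (Ψ (g + z)) g)) ∂noiseDiffLaw P
      ≤ 1 := by
  have := isProbabilityMeasure_noiseDiffLaw hP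
  have hΨm : Measurable fun z => Ψ (g + z) := hm.comp (measurable_const_add g)
  set X : Vec d → ℝ := fun z => inner ℝ (Ψ (g + z)) g with hX
  have hXm : Measurable X := by fun_prop
  have hXb : ∀ z, |X z| ≤ C * ‖g‖ := fun z =>
    (abs_real_inner_le_norm _ _).trans (mul_le_mul_of_nonneg_right (hC _) (norm_nonneg g))
  have hsub := hasSubgaussianMGF_of_mem_Icc (μ := noiseDiffLaw P) (a := -(C * ‖g‖))
    (b := C * ‖g‖) hXm.aemeasurable (Filter.Eventually.of_forall fun z => abs_le.1 (hXb z))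
  have hC0 : 0 ≤ C := (norm_nonneg _).trans (hC 0)
  have hvar : (((‖C * ‖g‖ - -(C * ‖g‖)‖₊ / 2) ^ 2 : ℝ≥0) : ℝ) = C ^ 2 * ‖g‖ ^ 2 := by
    push_cast
    rw [Real.norm_of_nonneg (by have := mul_nonneg hC0 (norm_nonneg g); linarith)]
    ring
  have hmgf := hsub.mgf_le (-α)
  rw [hvar] at hmgf
  set e := ∫ z, X z ∂noiseDiffLaw P with he
  have hbe : b ≤ e := by rwa [inner_denoised hP hm hC] at hb
  have hfact : ∀ z, Real.exp (α * b / 2 - α * X z) =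
      Real.exp (α * b / 2 - α * e) * Real.exp (-α * (X z - e)) := fun z => by
    rw [← Real.exp_add]; congr 1; ring
  have hint : Integrable (fun z => Real.exp (α * b / 2 - α * X z)) (noiseDiffLaw P) := by
    simp only [hfact]
    exact (hsub.integrable_exp_mul (-α)).const_mul _
  rw [← ofReal_integral_eq_lintegral_ofReal hint
    (Filter.Eventually.of_forall fun z => (Real.exp_pos _).le)]
  refine ENNReal.ofReal_le_one.2 ?_
  simp only [hfact]
  rw [integral_const_mul]
  have hmgf' : ∫ z, Real.exp (-α * (X z - e)) ∂noiseDiffLaw P ≤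
      Real.exp (C ^ 2 * ‖g‖ ^ 2 * (-α) ^ 2 / 2) := hmgf
  refine (mul_le_mul_of_nonneg_left hmgf' (Real.exp_pos _).le).trans ?_
  rw [← Real.exp_add]
  -- The exponent is `αb/2 - αe + α²C²‖g‖²/2`. Here `e ≥ b`, and the last term is at most `αb/2`.
  refine Real.exp_le_one_iff.2 ?_
  have h1 := mul_le_mul_of_nonneg_left hbe hα
  have h2 := mul_le_mul_of_nonneg_left hαb hα
  nlinarith

end OneStep

/-! ### Estimates for the step sizes. -/

section StepSizes

variable {a η : ℝ}

theorem stepSize_nonneg (ha : 0 < a) (t : ℕ) : 0 ≤ stepSize a η t := by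
  unfold stepSize
  positivity

/-- Bernoulli's inequality for the exponent `1 - η`; it bounds partial sums of `(k + 1)^(-η)` by
induction. -/
theorem rpow_add_le_rpow_succ (hη : 0 ≤ η) (hη1 : η < 1) {k : ℝ} (hk : 0 ≤ k) :
    k ^ (1 - η) + (1 - η) / (k + 1) ^ η ≤ (k + 1) ^ (1 - η) := by
  have hk1 : 0 < k + 1 := by positivity
  have hle : 1 / (k + 1) ≤ 1 := (div_le_one hk1).2 (by linarith)
  have hbern := rpow_one_add_le_one_add_mul_self (s := -(1 / (k + 1))) (by linarith)
    (p := 1 - η) (by linarith) (by linarith)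
  have hk' : k = (k + 1) * (1 + -(1 / (k + 1))) := by field_simp; ring
  have hsplit : (k + 1) ^ (1 - η) = (k + 1) / (k + 1) ^ η := by
    rw [Real.rpow_sub hk1, Real.rpow_one]
  calc k ^ (1 - η) + (1 - η) / (k + 1) ^ η
      = (k + 1) ^ (1 - η) * (1 + -(1 / (k + 1))) ^ (1 - η) + (1 - η) / (k + 1) ^ η := by
        rw [← Real.mul_rpow hk1.le (by linarith), ← hk']
    _ ≤ (k + 1) ^ (1 - η) * (1 + (1 - η) * -(1 / (k + 1))) + (1 - η) / (k + 1) ^ η := by gcongr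
    _ = (k + 1) ^ (1 - η) := by
        have : (k + 1) ^ η ≠ 0 := (Real.rpow_pos_of_pos hk1 _).ne'
        rw [hsplit]
        field_simp
        ring

/-- This is where `η ≥ 1/2` enters: `1 - η ≤ η`, so the steps decay at least as fast as the iterates
can drift away. -/
theorem stepSize_mul_rpow_le (ha : 0 < a) (hη : 1 / 2 ≤ η) {t : ℕ} (ht : 1 ≤ t) :
    stepSize a η t * (t : ℝ) ^ (1 - η) ≤ a := by
  have ht' : (1 : ℝ) ≤ t := by exact_mod_cast ht
  have h : (t : ℝ) ^ (1 - η) ≤ ((t : ℝ) + 1) ^ η :=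
    calc (t : ℝ) ^ (1 - η) ≤ (t : ℝ) ^ η := Real.rpow_le_rpow_of_exponent_le ht' (by linarith)
      _ ≤ ((t : ℝ) + 1) ^ η := Real.rpow_le_rpow (by linarith) (by linarith) (by linarith)
  rw [stepSize, div_mul_eq_mul_div, div_le_iff₀ (by positivity)]
  gcongr

theorem stepSize_le (ha : 0 < a) (hη : 0 ≤ η) (t : ℕ) : stepSize a η t ≤ a :=
  div_le_self ha.le (Real.one_le_rpow (by linarith [Nat.cast_nonneg (α := ℝ) t]) hη)

theorem stepSize_sq (t : ℕ) : stepSize a η t ^ 2 = a ^ 2 * ((t : ℝ) + 1) ^ (-2 * η) := by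
  have h0 : (0 : ℝ) ≤ (t : ℝ) + 1 := by positivity
  rw [stepSize, div_pow, ← Real.rpow_natCast (((t : ℝ) + 1) ^ η), ← Real.rpow_mul h0,
    div_eq_mul_inv, ← Real.rpow_neg h0]
  congr 2
  push_cast
  ring

theorem stepSize_antitone (ha : 0 < a) (hη : 0 ≤ η) {s t : ℕ} (hst : s ≤ t) :
    stepSize a η t ≤ stepSize a η s := by
  unfold stepSize
  gcongr

theorem div_le_stepSize_mul (ha : 0 < a) (hη : 0 ≤ η) (hη1 : η < 1) {t : ℕ} (ht : 1 ≤ t) :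
    a * (t : ℝ) ^ (1 - η) ≤ 2 * (stepSize a η t * t) := by
  have ht' : (1 : ℝ) ≤ t := by exact_mod_cast ht
  have ht0 : (0 : ℝ) < t := by linarith
  have hpow : ((t : ℝ) + 1) ^ η ≤ 2 * (t : ℝ) ^ η :=
    calc ((t : ℝ) + 1) ^ η ≤ (2 * (t : ℝ)) ^ η :=
          Real.rpow_le_rpow (by linarith) (by linarith) hη
      _ = 2 ^ η * (t : ℝ) ^ η := Real.mul_rpow (by norm_num) ht0.le
      _ ≤ 2 ^ (1 : ℝ) * (t : ℝ) ^ η := by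
          gcongr
          · norm_num
      _ = 2 * (t : ℝ) ^ η := by rw [Real.rpow_one]
  have hp : 0 < ((t : ℝ) + 1) ^ η := by positivity
  have hq : 0 < (t : ℝ) ^ η := by positivity
  rw [stepSize, Real.rpow_sub ht0, Real.rpow_one, div_mul_eq_mul_div, mul_div_assoc', mul_div_assoc',
    div_le_div_iff₀ hq hp]
  have := mul_le_mul_of_nonneg_left hpow (by positivity : 0 ≤ a * t)
  linarith

end StepSizes

/-! ### The trajectory of the method. -/

section Method

variable {d : ℕ} {Ω Ξ : Type*} {F : Vec d → ℝ} {f : Vec d → Ξ → ℝ}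
  {Ψ : Vec d → Vec d} {a η : ℝ} {x₁ y : Vec d} {ξ₁ ξ₂ : ℕ → Ω → Ξ} {x : ℕ → Ω → Vec d}

/-- The known gradient at `y` cancels the mean of the second oracle answer, leaving the true
gradient plus a symmetric noise. The noise drawn at time `n + 1` carries index `n`. -/
theorem IsNSGE.step_eq {α : ℕ → ℝ} (hx : IsNSGE F f Ψ α x₁ y ξ₁ ξ₂ x) (n : ℕ) (ω : Ω) :
    x (n + 2) ω = x (n + 1) ω - α (n + 1) •
      Ψ (gradient F (x (n + 1) ω) + noiseDiff (gradNoise F f y ξ₁ ξ₂ x) n ω) := by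
  rw [hx.step (n + 1) (by omega) ω]
  congr 3
  simp only [noiseDiff, gradNoise, Nat.succPNat_coe, Nat.succ_eq_add_one]
  abel

/-- The loss and the samples enter the recursion through the noise vectors only, so no measurability
of either is needed. -/
theorem IsNSGE.measurable_iterate {α : ℕ → ℝ} (hx : IsNSGE F f Ψ α x₁ y ξ₁ ξ₂ x)
    (hΨ : Measurable Ψ) (hF : Measurable (gradient F)) (n : ℕ) :
    Measurable[noiseSigma (gradNoise F f y ξ₁ ξ₂ x) (Set.Iic n)] (x (n + 1)) := by
  induction n with
  | zero =>
    rw [show x (0 + 1) = fun _ => x₁ from funext hx.init]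
    exact measurable_const
  | succ n ih =>
    rw [show x (n + 1 + 1) = fun ω => x (n + 1) ω - α (n + 1) •
      Ψ (gradient F (x (n + 1) ω) + noiseDiff (gradNoise F f y ξ₁ ξ₂ x) n ω) from
      funext (hx.step_eq n)]
    have hstep : Measurable fun p : Vec d × Vec d => p.1 - α (n + 1) • Ψ (gradient F p.1 + p.2) := by
      fun_prop
    have h1 := ih.mono (noiseSigma_mono (gradNoise F f y ξ₁ ξ₂ x)
      (Set.Iic_subset_Iic.2 n.le_succ)) le_rfl
    have h2 := measurable_noiseDiff (gradNoise F f y ξ₁ ξ₂ x) (s := Set.Iic (n + 1)) (n := n)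
      (Set.mem_Iic.2 le_rfl)
    exact hstep.comp (h1.prodMk h2)

theorem IsNSGE.norm_iterate_sub_le (hx : IsNSGE F f Ψ (stepSize a η) x₁ y ξ₁ ξ₂ x) {C : ℝ}
    (hC : ∀ u, ‖Ψ u‖ ≤ C) (ha : 0 < a) (hη : 0 ≤ η) (hη1 : η < 1) (n : ℕ) (ω : Ω) :
    ‖x (n + 1) ω - x₁‖ ≤ a * C / (1 - η) * ((n + 1 : ℕ) : ℝ) ^ (1 - η) := by
  have hC0 : 0 ≤ C := (norm_nonneg _).trans (hC 0)
  have h1η : 0 < 1 - η := by linarith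
  induction n with
  | zero =>
    rw [hx.init, sub_self, norm_zero]
    positivity
  | succ n ih =>
    have hpow := rpow_add_le_rpow_succ hη hη1 (k := ((n + 1 : ℕ) : ℝ)) (by positivity)
    rw [hx.step_eq, sub_right_comm]
    calc _ ≤ ‖x (n + 1) ω - x₁‖ + ‖stepSize a η (n + 1) •
          Ψ (gradient F (x (n + 1) ω) + noiseDiff (gradNoise F f y ξ₁ ξ₂ x) n ω)‖ := norm_sub_le _ _
      _ ≤ a * C / (1 - η) * ((n + 1 : ℕ) : ℝ) ^ (1 - η) + stepSize a η (n + 1) * C := by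
          rw [norm_smul, Real.norm_of_nonneg (stepSize_nonneg ha _)]
          gcongr
          · exact stepSize_nonneg ha _
          · exact hC _
      _ = a * C / (1 - η) * (((n + 1 : ℕ) : ℝ) ^ (1 - η) +
            (1 - η) / (((n + 1 : ℕ) : ℝ) + 1) ^ η) := by
          rw [stepSize]
          field_simp
      _ ≤ _ := by
          rw [Nat.cast_succ (n + 1)]
          gcongr

/-- Along the trajectory the variance term is dominated by the drift. -/
theorem IsNSGE.stepSize_mul_sq_le (hx : IsNSGE F f Ψ (stepSize a η) x₁ y ξ₁ ξ₂ x) {C γ₁ γ₂ : ℝ}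
    {L : ℝ≥0} (hF : IsSmoothCost F L) (hC0 : 0 < C) (hC : ∀ u, ‖Ψ u‖ ≤ C) (hγ₁ : 0 < γ₁)
    (ha : 0 < a) (ha1 : a ≤ 1) (hη : 1 / 2 ≤ η) (hη1 : η < 1) (haγ₂ : a ≤ γ₂ / (8 * C ^ 2))
    (haγ₁ : a * (8 * C ^ 2 * (L * C + (1 - η) * ‖gradient F x₁‖)) ≤ (1 - η) * γ₁)
    (n : ℕ) (ω : Ω) :
    stepSize a η (n + 1) * C ^ 2 * ‖gradient F (x (n + 1) ω)‖ ^ 2 ≤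
      min (γ₁ * ‖gradient F (x (n + 1) ω)‖) (γ₂ * ‖gradient F (x (n + 1) ω)‖ ^ 2) := by
  set g := ‖gradient F (x (n + 1) ω)‖ with hg
  set α := stepSize a η (n + 1) with hα
  have hg0 : 0 ≤ g := norm_nonneg _
  have hα0 : 0 ≤ α := stepSize_nonneg ha _
  have hαa : α ≤ a := stepSize_le ha (by linarith) _
  have h1η : 0 < 1 - η := by linarith
  have hαp : α * ((n + 1 : ℕ) : ℝ) ^ (1 - η) ≤ a := stepSize_mul_rpow_le ha hη (by omega)
  have hgrad : g ≤ ‖gradient F x₁‖ + L * (a * C / (1 - η) * ((n + 1 : ℕ) : ℝ) ^ (1 - η)) := by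
    have h1 := hF.lipschitz.dist_le_mul (x (n + 1) ω) x₁
    rw [dist_eq_norm, dist_eq_norm] at h1
    have h2 := norm_le_norm_add_norm_sub' (gradient F (x (n + 1) ω)) (gradient F x₁)
    have h3 := mul_le_mul_of_nonneg_left
      (hx.norm_iterate_sub_le hC ha (by linarith) hη1 n ω) L.coe_nonneg
    linarith
  -- The growth of the gradient is absorbed by the step size; one of the two factors `a` in the
  -- Lipschitz term is bounded by `1`.
  have hαg : (1 - η) * (α * g) ≤ a * (L * C + (1 - η) * ‖gradient F x₁‖) :=
    calc (1 - η) * (α * g) ≤ (1 - η) * (α *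
          (‖gradient F x₁‖ + L * (a * C / (1 - η) * ((n + 1 : ℕ) : ℝ) ^ (1 - η)))) := by gcongr
      _ = (1 - η) * (α * ‖gradient F x₁‖) +
          L * a * C * (α * ((n + 1 : ℕ) : ℝ) ^ (1 - η)) := by field_simp
      _ ≤ (1 - η) * (a * ‖gradient F x₁‖) + L * 1 * C * a := by gcongr
      _ = _ := by ring
  refine le_min ?_ ?_
  · have h1 : (1 - η) * (8 * (α * C ^ 2 * g)) ≤ (1 - η) * γ₁ := by
      refine le_trans ?_ haγ₁
      have := mul_le_mul_of_nonneg_left hαg (by positivity : 0 ≤ 8 * C ^ 2)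
      linarith
    have h2 := le_of_mul_le_mul_left h1 h1η
    have h3 : α * C ^ 2 * g ≤ γ₁ := by
      have : 0 ≤ α * C ^ 2 * g := by positivity
      linarith
    calc α * C ^ 2 * g ^ 2 = α * C ^ 2 * g * g := by ring
      _ ≤ γ₁ * g := by gcongr
  · rw [le_div_iff₀ (by positivity)] at haγ₂
    have h1 : α * C ^ 2 ≤ a * C ^ 2 := by gcongr
    have h2 : 0 ≤ a * C ^ 2 := by positivity
    gcongr
    linarith

/-- The descent of the cost over the first `n` steps. -/
theorem IsNSGE.cost_le (hx : IsNSGE F f Ψ (stepSize a η) x₁ y ξ₁ ξ₂ x) {C : ℝ} {L : ℝ≥0}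
    (hF : IsSmoothCost F L) (hC : ∀ u, ‖Ψ u‖ ≤ C) (n : ℕ) (ω : Ω) :
    F (x (n + 1) ω) ≤ F x₁
      - ∑ k ∈ Finset.range n, stepSize a η (k + 1) *
          inner ℝ (Ψ (gradient F (x (k + 1) ω) + noiseDiff (gradNoise F f y ξ₁ ξ₂ x) k ω))
            (gradient F (x (k + 1) ω))
      + L / 2 * C ^ 2 * ∑ k ∈ Finset.range n, stepSize a η (k + 1) ^ 2 := by
  induction n with
  | zero => simp [hx.init]
  | succ n ih =>
    set w := Ψ (gradient F (x (n + 1) ω) + noiseDiff (gradNoise F f y ξ₁ ξ₂ x) n ω) with hw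
    have hstep := hF.le_quadratic (x (n + 1) ω) (-(stepSize a η (n + 1) • w))
    rw [← sub_eq_add_neg, ← hx.step_eq, inner_neg_right, real_inner_smul_right, norm_neg,
      norm_smul, mul_pow, Real.norm_eq_abs, sq_abs, real_inner_comm] at hstep
    have hwC : ‖w‖ ^ 2 ≤ C ^ 2 := pow_le_pow_left₀ (norm_nonneg _) (hC _) 2
    have hquad := mul_le_mul_of_nonneg_left hwC
      (by positivity : 0 ≤ (L : ℝ) / 2 * stepSize a η (n + 1) ^ 2)
    rw [Finset.sum_range_succ, Finset.sum_range_succ]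
    linarith

/-- The averaged bound follows once the exponential supermartingale stays below `log (1 / δ)`. -/
theorem IsNSGE.average_le (hx : IsNSGE F f Ψ (stepSize a η) x₁ y ξ₁ ξ₂ x) {C γ₁ γ₂ D : ℝ}
    {L : ℝ≥0} (hF : IsSmoothCost F L) (hC : ∀ u, ‖Ψ u‖ ≤ C) (hγ₁ : 0 < γ₁) (hγ₂ : 0 < γ₂)
    (ha : 0 < a) (hη : 0 ≤ η) (hη1 : η < 1) {t : ℕ} (ht : 1 ≤ t) {ω : Ω}
    (hD : ∑ k ∈ Finset.range t, (stepSize a η (k + 1) *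
        min (γ₁ * ‖gradient F (x (k + 1) ω)‖) (γ₂ * ‖gradient F (x (k + 1) ω)‖ ^ 2) / 2 -
      stepSize a η (k + 1) *
        inner ℝ (Ψ (gradient F (x (k + 1) ω) + noiseDiff (gradNoise F f y ξ₁ ξ₂ x) k ω))
          (gradient F (x (k + 1) ω))) ≤ D) :
    1 / (t : ℝ) * ∑ k ∈ Finset.Icc 1 t,
        min ‖gradient F (x k ω)‖ (‖gradient F (x k ω)‖ ^ 2)
      ≤ 4 * (D + (F x₁ - ⨅ u, F u)) / (a * min γ₁ γ₂ * (t : ℝ) ^ (1 - η))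
        + 2 * a * L * C ^ 2 / (min γ₁ γ₂ * (t : ℝ) ^ (1 - η))
            * ∑ k ∈ Finset.Icc 1 t, ((k : ℝ) + 1) ^ (-2 * η) := by
  have hIcc : ∀ h : ℕ → ℝ, ∑ k ∈ Finset.Icc 1 t, h k = ∑ k ∈ Finset.range t, h (k + 1) := by
    intro h
    rw [Finset.range_eq_Ico, Finset.sum_Ico_add' h 0 t 1]
    rfl
  rw [hIcc, hIcc]
  set S := ∑ k ∈ Finset.range t, min ‖gradient F (x (k + 1) ω)‖
    (‖gradient F (x (k + 1) ω)‖ ^ 2) with hS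
  set Q := ∑ k ∈ Finset.range t, (((k + 1 : ℕ) : ℝ) + 1) ^ (-2 * η) with hQ
  have hγ : 0 < min γ₁ γ₂ := lt_min hγ₁ hγ₂
  have ht0 : (0 : ℝ) < t := by exact_mod_cast ht
  have hS0 : 0 ≤ S := Finset.sum_nonneg fun k _ => le_min (norm_nonneg _) (sq_nonneg _)
  have hcost := hx.cost_le hF hC t ω
  have hsq : ∑ k ∈ Finset.range t, stepSize a η (k + 1) ^ 2 = a ^ 2 * Q := by
    rw [hQ, Finset.mul_sum]
    exact Finset.sum_congr rfl fun k _ => stepSize_sq _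
  rw [hsq] at hcost
  have hinf := ciInf_le hF.bddBelow (x (t + 1) ω)
  rw [Finset.sum_sub_distrib, ← Finset.sum_div] at hD
  -- The last step size is the smallest, and `min γ₁ γ₂` is below both constants.
  have hdrift : stepSize a η t * min γ₁ γ₂ * S ≤ ∑ k ∈ Finset.range t, stepSize a η (k + 1) *
      min (γ₁ * ‖gradient F (x (k + 1) ω)‖) (γ₂ * ‖gradient F (x (k + 1) ω)‖ ^ 2) := by
    rw [hS, Finset.mul_sum]
    refine Finset.sum_le_sum fun k hk => ?_
    rw [mul_assoc]
    refine mul_le_mul (stepSize_antitone ha hη (Finset.mem_range.1 hk)) (le_min ?_ ?_)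
      (mul_nonneg hγ.le (le_min (norm_nonneg _) (sq_nonneg _))) (stepSize_nonneg ha _)
    · exact mul_le_mul (min_le_left _ _) (min_le_left _ _)
        (le_min (norm_nonneg _) (sq_nonneg _)) hγ₁.le
    · exact mul_le_mul (min_le_right _ _) (min_le_right _ _)
        (le_min (norm_nonneg _) (sq_nonneg _)) hγ₂.le
  have hmain : stepSize a η t * min γ₁ γ₂ * S ≤
      2 * (D + (F x₁ - ⨅ u, F u)) + L * C ^ 2 * a ^ 2 * Q := by linarith
  have hpow : 0 < (t : ℝ) ^ (1 - η) := by positivity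
  have hstep := mul_le_mul_of_nonneg_right (div_le_stepSize_mul ha hη hη1 ht)
    (mul_nonneg hγ.le hS0)
  -- Obtained from `hmain` times `2 * t`, with `a t^(1-η) ≤ 2 α_t t` on the left.
  have hfin : a * min γ₁ γ₂ * (t : ℝ) ^ (1 - η) * S ≤
      t * (4 * (D + (F x₁ - ⨅ u, F u)) + 2 * a * L * C ^ 2 * a * Q) := by
    have := mul_le_mul_of_nonneg_left hmain (by positivity : 0 ≤ 2 * (t : ℝ))
    linarith
  have hrhs : 4 * (D + (F x₁ - ⨅ u, F u)) / (a * min γ₁ γ₂ * (t : ℝ) ^ (1 - η))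
        + 2 * a * L * C ^ 2 / (min γ₁ γ₂ * (t : ℝ) ^ (1 - η)) * Q =
      (4 * (D + (F x₁ - ⨅ u, F u)) + 2 * a * L * C ^ 2 * a * Q) /
        (a * min γ₁ γ₂ * (t : ℝ) ^ (1 - η)) := by
    field_simp
  rw [hrhs, one_div_mul_eq_div, div_le_div_iff₀ ht0 (by positivity)]
  linarith

end Method

theorem theorem2 {d : ℕ} (P : Vec d → ℝ) (hP : IsPDF P) (hS : HasPositiveOverlap P)
    (Ψ : Vec d → Vec d) (hΨ : IsAdmissibleNonlinearity Ψ) :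
    -- admissible constants exist; they depend on the noise density and the nonlinearity only
    (∃ γ₁ γ₂ : ℝ, AreDenoisingConstants P Ψ γ₁ γ₂) ∧
    -- and for all such constants, and every uniform bound `C` of the nonlinearity:
    ∀ γ₁ γ₂ : ℝ, AreDenoisingConstants P Ψ γ₁ γ₂ →
    ∀ C : ℝ, 0 < C → (∀ u, ‖Ψ u‖ ≤ C) →
    ∀ (Ω : Type*) [MeasurableSpace Ω] (μ : Measure Ω) [IsProbabilityMeasure μ] (Ξ : Type*)
      (F : Vec d → ℝ) (L : ℝ≥0) (f : Vec d → Ξ → ℝ) (x₁ y : Vec d)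
      (ξ₁ ξ₂ : ℕ → Ω → Ξ) (x : ℕ → Ω → Vec d) (a η : ℝ),
      IsSmoothCost F L →
      (∀ ξ, Differentiable ℝ fun u => f u ξ) →
      IsNSGE F f Ψ (stepSize a η) x₁ y ξ₁ ξ₂ x →
      IsIIDWithPDF μ (gradNoise F f y ξ₁ ξ₂ x) P →
      1 / 2 ≤ η → η < 1 → 0 < a →
      -- `a ≤ min {1, γ₂ / (8C²), (1-η)γ₁ / (8C²(LC + (1-η)‖∇F(x₁)‖))}`; the last bound is
      -- multiplied out, so that it is void if its denominator vanishes
      a ≤ 1 → a ≤ γ₂ / (8 * C ^ 2) →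
      a * (8 * C ^ 2 * (L * C + (1 - η) * ‖gradient F x₁‖)) ≤ (1 - η) * γ₁ →
      ∀ t : ℕ, 1 ≤ t → ∀ δ : ℝ, 0 < δ → δ < 1 →
        ENNReal.ofReal (1 - δ) ≤ μ {ω |
          1 / (t : ℝ) * ∑ k ∈ Finset.Icc 1 t,
              min ‖gradient F (x k ω)‖ (‖gradient F (x k ω)‖ ^ 2)
            ≤ 4 * (Real.log (1 / δ) + (F x₁ - ⨅ u, F u))
                  / (a * min γ₁ γ₂ * (t : ℝ) ^ (1 - η))
              + 2 * a * L * C ^ 2 / (min γ₁ γ₂ * (t : ℝ) ^ (1 - η))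
                  * ∑ k ∈ Finset.Icc 1 t, ((k : ℝ) + 1) ^ (-2 * η)} := by

  refine ⟨exists_denoisingConstants hP hΨ, ?_⟩
  intro γ₁ γ₂ hγ C hC0 hC Ω _ μ _ Ξ F L f x₁ y ξ₁ ξ₂ x a η hF _ hx hZ hη hη1 ha ha1 haγ₂ haγ₁ t ht
    δ hδ _
  obtain ⟨hγ₁, hγ₂, hdrift⟩ := hγ
  have hΨm := hΨ.measurable
  have hGm : Measurable (gradient F) := hF.lipschitz.continuous.measurable
  -- `q n` is the logarithmic increment of the supermartingale: half the guaranteed drift minus the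
  -- realised one. It is kept opaque, to be unfolded only through `hq`.
  obtain ⟨q, hq⟩ : ∃ q : ℕ → Vec d → Vec d → ℝ, ∀ n u z, q n u z = stepSize a η (n + 1) *
      min (γ₁ * ‖gradient F u‖) (γ₂ * ‖gradient F u‖ ^ 2) / 2 -
    stepSize a η (n + 1) * inner ℝ (Ψ (gradient F u + z)) (gradient F u) :=
    ⟨_, fun _ _ _ => rfl⟩
  have hqm : ∀ n, Measurable (Function.uncurry (q n)) := fun n => by
    simp only [Function.uncurry_def, hq]
    fun_prop
  have hX := hx.measurable_iterate hΨm hGm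
  have hone : ∀ n ω, ∫⁻ z, ENNReal.ofReal (Real.exp (q n (x (n + 1) ω) z)) ∂noiseDiffLaw P ≤ 1 :=
    fun n ω => by
      simp only [hq]
      exact lintegral_exp_drift_le hP hΨm hC (gradient F (x (n + 1) ω))
        (stepSize_nonneg ha (n + 1)) (hdrift _)
        (hx.stepSize_mul_sq_le hF hC0 hC hγ₁ ha ha1 hη hη1 haγ₂ haγ₁ n ω)
  have hle := lintegral_exp_sum_le_one (X := fun n => x (n + 1)) hZ hqm hX hone t
  have hsum : Measurable fun ω => ∑ k ∈ Finset.range t,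
      q k (x (k + 1) ω) (noiseDiff (gradNoise F f y ξ₁ ξ₂ x) k ω) := by
    refine Finset.measurable_sum _ fun k _ => ?_
    have h1 : Measurable (x (k + 1)) := (hX k).mono (noiseSigma_le hZ.measurable _) le_rfl
    have h2 : Measurable (noiseDiff (gradNoise F f y ξ₁ ξ₂ x) k) :=
      (measurable_noiseDiff _ (Set.mem_univ _)).mono (noiseSigma_le hZ.measurable Set.univ) le_rfl
    exact (hqm k).comp (h1.prodMk h2)
  refine (ofReal_one_sub_le_measure_of_lintegral_exp_le_one hsum hle hδ).trans
    (measure_mono fun ω hω => ?_)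
  rw [Set.mem_ofPred_eq] at hω
  have hω' := hω.le
  simp only [hq] at hω'
  exact hx.average_le hF hC hγ₁ hγ₂ ha (by linarith) hη1 ht hω'
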